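/- Notation. Let $\mathbb H$ be the upper half plane, $z\in\mathbb C$, $\tau\in\mathbb H$, $p=e^{2\pi i z}$, $q=e^{2\pi i\tau}$, and write $F'=\frac1{2\pi i}\frac{\partial F}{\partial\tau}$, $F^{\bullet}=\frac1{2\pi i}\frac{\partial F}{\partial z}$. Let $E_2=1-24\sum_{n\ge1}\sigma_1(n)q^n$. For $k\in\mathbb Z$ and an integer $m\ge0$ let $\mathcal J_{k,m}$ be the complex vector space of Jacobi forms of weight $k$ and index $m$, i.e. of holomorphic functions $F:\mathbb C\times\mathbb H\to\mathbb C$ such that $$F\Big(\frac{z}{c\tau+d},\frac{a\tau+b}{c\tau+d}\Big)=(c\tau+d)^k e^{2\pi i m\frac{cz^2}{c\tau+d}}F(z,\tau),\qquad F(z+\lambda\tau+\mu,\tau)=e^{-2\pi i m(\lambda^2\tau+2\lambda z)}F(z,\tau)$$ for all $\begin{pmatrix}a&b\\c&d\end{pmatrix}\in SL_2(\mathbb Z)$ and $\lambda,\mu\in\mathbb Z$, and such that $F$ has a Fourier expansion $\sum_{n\ge0}\sum_{r\in\mathbb Z,\ r^2\le4nm}c(n,r)p^rq^n$. With the Bernoulli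 numbers $B_n$ given by $x/(e^x-1)=\sum_n B_nx^n/n!$, let $$J_n(z,\tau)=\delta_{n,1}\frac{p}{p-1}+B_n-n\sum_{k,r\ge1}r^{n-1}\big(p^k+(-1)^np^{-k}\big)q^{kr}$$ for $|\operatorname{Im}z|<\operatorname{Im}\tau$, continued to a meromorphic function of $z\in\mathbb C$ which is holomorphic outside $\mathbb Z\tau+\mathbb Z$. Theorem. For all integers $k,m\ge0$ there is a linear differential operator $\partial^J:\mathcal J_{2k,m}\to\mathcal J_{2k+2,m}$ given by the formula $$\partial^JF=F'-\frac{2k}{12}E_2F+\frac{1}{1-4m}\Big(F^{\bullet\bullet}-J_1F^{\bullet}+mJ_2F-\frac m6E_2F\Big)$$ (at all points $(z,\tau)$ with $z\notin\mathbb Z\tau+\mathbb Z$, hence everywhere by holomorphic extension in $z$). For every $F\in\mathcal J_{2k,m}$ and $\tau\in\mathbb H$ it satisfies $$(\partial^JF)(0,\tau)=\partial^S\big(F(0,\tau)\big),$$ where $\partial^S f=f'-\frac{2k}{12}E_2f$ is the classical Serre derivative in weight $2k$. -/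

import Mathlib

open UpperHalfPlane hiding I
open Complex
open scoped Real MatrixGroups

noncomputable section

namespace JacobiSerre

/-- The nome `q = exp(2πiτ)`. -/
def nome (τ : ℍ) : ℂ := cexp (2 * π * I * τ)

/-- The elliptic nome `p = exp(2πiz)`. -/
def ellNome (z : ℂ) : ℂ := cexp (2 * π * I * z)

/-- The functions `F : ℂ → ℍ → ℂ` (written `F(z,τ)`) that are Jacobi forms of weight `k` and index
`m` for the full Jacobi group `SL₂(ℤ) ⋉ ℤ²`. -/
structure IsJacobiForm (k : ℤ) (m : ℕ) (F : ℂ → ℍ → ℂ) : Prop where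
  /-- `F` is jointly holomorphic on `ℂ × ℍ`. -/
  holomorphic : DifferentiableOn ℂ (fun x : ℂ × ℂ => F x.1 (ofComplex x.2)) {x | 0 < x.2.im}
  /-- The modular transformation law; `denom γ τ = cτ + d` and `γ 1 0 = c`. -/
  modular : ∀ (γ : SL(2, ℤ)) (z : ℂ) (τ : ℍ),
    F (z / denom γ τ) (γ • τ) =
      denom γ τ ^ k * cexp (2 * π * I * m * (γ 1 0 : ℂ) * z ^ 2 / denom γ τ) * F z τ
  /-- The elliptic transformation law. -/
  elliptic : ∀ (l u : ℤ) (z : ℂ) (τ : ℍ),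
    F (z + l * τ + u) τ = cexp (-(2 * π * I * m * ((l : ℂ) ^ 2 * τ + 2 * l * z))) * F z τ
  /-- The Fourier expansion `∑ c(n,r) p^r q^n` over `n ≥ 0` and `r ∈ ℤ` with `r² ≤ 4nm`. -/
  fourier : ∃ c : ℕ → ℤ → ℂ, (∀ (n : ℕ) (r : ℤ), 4 * (n : ℤ) * m < r ^ 2 → c n r = 0) ∧
    ∀ (z : ℂ) (τ : ℍ),
      HasSum (fun x : ℕ × ℤ => c x.1 x.2 * ellNome z ^ x.2 * nome τ ^ x.1) (F z τ)

/-- The complex vector space of Jacobi forms of weight `k` and index `m`. -/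
def jacobiForms (k : ℤ) (m : ℕ) : Submodule ℂ (ℂ → ℍ → ℂ) where
  carrier := {F | IsJacobiForm k m F}
  zero_mem' :=
    { holomorphic := by simp
      modular := by simp
      elliptic := by simp
      fourier := ⟨0, by simp, by simp [hasSum_zero]⟩ }
  add_mem' := by
    intro F G hF hG
    obtain ⟨c, hc, hc'⟩ := hF.fourier
    obtain ⟨d, hd, hd'⟩ := hG.fourier
    refine ⟨hF.holomorphic.add hG.holomorphic, ?_, ?_, c + d, ?_, ?_⟩
    · intro γ z τ
      simp only [Pi.add_apply, hF.modular, hG.modular, mul_add]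
    · intro l u z τ
      simp only [Pi.add_apply, hF.elliptic, hG.elliptic, mul_add]
    · intro n r h
      simp [hc n r h, hd n r h]
    · intro z τ
      simpa [add_mul] using (hc' z τ).add (hd' z τ)
  smul_mem' := by
    intro a F hF
    obtain ⟨c, hc, hc'⟩ := hF.fourier
    refine ⟨hF.holomorphic.const_smul a, ?_, ?_, a • c, ?_, ?_⟩
    · intro γ z τ
      simp only [Pi.smul_apply, smul_eq_mul, hF.modular]
      ring
    · intro l u z τ
      simp only [Pi.smul_apply, smul_eq_mul, hF.elliptic]
      ring
    · intro n r h
      simp [hc n r h]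
    · intro z τ
      simpa [mul_assoc] using (hc' z τ).mul_left a

/-- `F^• = (2πi)⁻¹ ∂F/∂z`. -/
def zDeriv (F : ℂ → ℍ → ℂ) (z : ℂ) (τ : ℍ) : ℂ :=
  (2 * π * I)⁻¹ * deriv (fun w => F w τ) z

/-- `F' = (2πi)⁻¹ ∂F/∂τ`. -/
def tauDeriv (F : ℂ → ℍ → ℂ) (z : ℂ) (τ : ℍ) : ℂ :=
  Derivative.normalizedDerivOfComplex (F z) τ

/-- The defining `p,q`-expansion of the deformed Eisenstein series `J_n`; the double series converges
for `|Im z| < Im τ`. -/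
def deformedEisensteinSeries (n : ℕ) (z : ℂ) (τ : ℍ) : ℂ :=
  (if n = 1 then ellNome z / (ellNome z - 1) else 0) + (bernoulli n : ℂ) -
    n * ∑' x : ℕ+ × ℕ+, ((x.2 : ℕ) : ℂ) ^ (n - 1) *
      (ellNome z ^ (x.1 : ℕ) + (-1) ^ n * (ellNome z)⁻¹ ^ (x.1 : ℕ)) *
        nome τ ^ ((x.1 : ℕ) * (x.2 : ℕ))

/-- The deformed Eisenstein series `J_n(z,τ)` as a meromorphic function of `z ∈ ℂ`, with poles only
at lattice points `z ∈ ℤτ + ℤ`. It is obtained from `deformedEisensteinSeries` by summing the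
geometric series over the first index. See `deformedEisenstein_eq_series` and
`differentiableAt_deformedEisenstein`: it is the analytic continuation of the defining series. -/
def deformedEisenstein (n : ℕ) (z : ℂ) (τ : ℍ) : ℂ :=
  (if n = 1 then ellNome z / (ellNome z - 1) else 0) + (bernoulli n : ℂ) -
    n * ∑' r : ℕ+, ((r : ℕ) : ℂ) ^ (n - 1) *
      (ellNome z * nome τ ^ (r : ℕ) / (1 - ellNome z * nome τ ^ (r : ℕ)) +
        (-1) ^ n * ((ellNome z)⁻¹ * nome τ ^ (r : ℕ) / (1 - (ellNome z)⁻¹ * nome τ ^ (r : ℕ))))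

lemma norm_nome_pos (τ : ℍ) : 0 < ‖nome τ‖ := by simp [nome]

lemma norm_nome (τ : ℍ) : ‖nome τ‖ = Real.exp (-(2 * π * τ.im)) := by
  simp [nome, Complex.norm_exp]

lemma norm_ellNome (z : ℂ) : ‖ellNome z‖ = Real.exp (-(2 * π * z.im)) := by
  simp [ellNome, Complex.norm_exp]

lemma norm_nome_lt_one (τ : ℍ) : ‖nome τ‖ < 1 := by
  rw [norm_nome, Real.exp_lt_one_iff]
  have := mul_pos Real.pi_pos τ.im_pos
  linarith

lemma summable_pow_mul_norm_nome (N : ℕ) (τ : ℍ) :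
    Summable (fun r : ℕ+ => ((r : ℕ) : ℝ) ^ N * ‖nome τ‖ ^ (r : ℕ)) := by
  have h := summable_pow_mul_geometric_of_norm_lt_one (R := ℝ) N
    (r := ‖nome τ‖) (by simpa using norm_nome_lt_one τ)
  exact h.comp_injective PNat.coe_injective

lemma summable_double (N : ℕ) (τ : ℍ) {x : ℂ} (hx : ‖x‖ * ‖nome τ‖ < 1) :
    Summable (fun y : ℕ+ × ℕ+ =>
      ((y.2 : ℕ) : ℂ) ^ N * x ^ (y.1 : ℕ) * nome τ ^ ((y.1 : ℕ) * (y.2 : ℕ))) := by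
  have h0 := norm_nome_pos τ
  have h1 : Summable (fun k : ℕ+ => (‖x‖ * ‖nome τ‖) ^ (k : ℕ)) :=
    (summable_geometric_of_lt_one (by positivity) hx).comp_injective PNat.coe_injective
  have h2 := (summable_pow_mul_norm_nome N τ).mul_right ‖nome τ‖⁻¹
  have h3 := h1.mul_of_nonneg h2 (fun _ => by positivity) (fun _ => by positivity)
  refine Summable.of_norm_bounded h3 ?_
  rintro ⟨k, r⟩
  obtain ⟨a, ha⟩ : ∃ a, (k : ℕ) = a + 1 := ⟨k - 1, by have := k.pos; omega⟩
  obtain ⟨b, hb⟩ : ∃ b, (r : ℕ) = b + 1 := ⟨r - 1, by have := r.pos; omega⟩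
  simp only [norm_mul, norm_pow, Complex.norm_natCast, ha, hb]
  have h4 : ‖nome τ‖ ^ ((a + 1) * (b + 1)) ≤ ‖nome τ‖ ^ (a + 1) * ‖nome τ‖ ^ b := by
    rw [← pow_add]
    exact pow_le_pow_of_le_one h0.le (norm_nome_lt_one τ).le (by nlinarith [Nat.zero_le (a * b)])
  calc _ ≤ ((b + 1 : ℕ) : ℝ) ^ N * ‖x‖ ^ (a + 1) * (‖nome τ‖ ^ (a + 1) * ‖nome τ‖ ^ b) := by
        gcongr
    _ = _ := by
        rw [mul_pow, pow_succ ‖nome τ‖ b]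
        field_simp

lemma tsum_double (N : ℕ) (τ : ℍ) {x : ℂ} (hx : ‖x‖ * ‖nome τ‖ < 1) :
    ∑' y : ℕ+ × ℕ+, ((y.2 : ℕ) : ℂ) ^ N * x ^ (y.1 : ℕ) * nome τ ^ ((y.1 : ℕ) * (y.2 : ℕ)) =
      ∑' r : ℕ+, ((r : ℕ) : ℂ) ^ N * (x * nome τ ^ (r : ℕ) / (1 - x * nome τ ^ (r : ℕ))) := by
  have hs := summable_double N τ hx
  rw [← (Equiv.prodComm ℕ+ ℕ+).tsum_eq]
  refine (Summable.tsum_prod ((Equiv.prodComm ℕ+ ℕ+).summable_iff.mpr hs)).trans ?_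
  refine tsum_congr fun r => ?_
  have hy : ‖x * nome τ ^ (r : ℕ)‖ < 1 := by
    rw [norm_mul, norm_pow]
    refine lt_of_le_of_lt ?_ hx
    gcongr
    exact pow_le_of_le_one (norm_nonneg _) (norm_nome_lt_one τ).le r.ne_zero
  have hg : ∑' k : ℕ+, (x * nome τ ^ (r : ℕ)) ^ (k : ℕ) =
      x * nome τ ^ (r : ℕ) / (1 - x * nome τ ^ (r : ℕ)) := by
    rw [tsum_pnat_eq_tsum_succ (f := fun k => (x * nome τ ^ (r : ℕ)) ^ k)]
    simp only [pow_succ _ _, tsum_mul_right, tsum_geometric_of_norm_lt_one hy]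
    ring
  rw [← hg, ← tsum_mul_left]
  refine tsum_congr fun k => ?_
  simp only [Function.comp, Equiv.prodComm_apply, Prod.swap, mul_pow, ← pow_mul, mul_comm (r : ℕ) (k : ℕ)]
  ring

lemma summable_single (N : ℕ) (τ : ℍ) {x : ℂ} (hx : ‖x‖ * ‖nome τ‖ < 1) :
    Summable fun r : ℕ+ =>
      ((r : ℕ) : ℂ) ^ N * (x * nome τ ^ (r : ℕ) / (1 - x * nome τ ^ (r : ℕ))) := by
  have hs := (Equiv.prodComm ℕ+ ℕ+).summable_iff.mpr (summable_double N τ hx)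
  refine hs.prod.congr fun r => ?_
  have hy : ‖x * nome τ ^ (r : ℕ)‖ < 1 := by
    rw [norm_mul, norm_pow]
    refine lt_of_le_of_lt ?_ hx
    gcongr
    exact pow_le_of_le_one (norm_nonneg _) (norm_nome_lt_one τ).le r.ne_zero
  have hg : ∑' k : ℕ+, (x * nome τ ^ (r : ℕ)) ^ (k : ℕ) =
      x * nome τ ^ (r : ℕ) / (1 - x * nome τ ^ (r : ℕ)) := by
    rw [tsum_pnat_eq_tsum_succ (f := fun k => (x * nome τ ^ (r : ℕ)) ^ k)]
    simp only [pow_succ _ _, tsum_mul_right, tsum_geometric_of_norm_lt_one hy]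
    ring
  rw [← hg, ← tsum_mul_left]
  refine tsum_congr fun k => ?_
  simp only [Function.comp, Equiv.prodComm_apply, Prod.swap, mul_pow, ← pow_mul,
    mul_comm (r : ℕ) (k : ℕ)]
  ring

/-- On the strip where the defining double series converges, `deformedEisenstein` is its value. -/
theorem deformedEisenstein_eq_series (n : ℕ) (z : ℂ) (τ : ℍ) (h : |z.im| < τ.im) :
    deformedEisenstein n z τ = deformedEisensteinSeries n z τ := by
  obtain ⟨h1, h2⟩ := abs_lt.mp h
  have hp : ‖ellNome z‖ * ‖nome τ‖ < 1 := by
    rw [norm_nome, norm_ellNome, ← Real.exp_add, Real.exp_lt_one_iff]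
    nlinarith [Real.pi_pos]
  have hp' : ‖(ellNome z)⁻¹‖ * ‖nome τ‖ < 1 := by
    rw [norm_inv, norm_nome, norm_ellNome, ← Real.exp_neg, ← Real.exp_add, Real.exp_lt_one_iff]
    nlinarith [Real.pi_pos]
  rw [deformedEisenstein, deformedEisensteinSeries]
  congr 2
  have e1 := tsum_double (n - 1) τ hp
  have e2 := tsum_double (n - 1) τ hp'
  have s1 := summable_double (n - 1) τ hp
  have s2 := (summable_double (n - 1) τ hp').mul_left ((-1) ^ n)
  have t1 := summable_single (n - 1) τ hp
  have t2 := (summable_single (n - 1) τ hp').mul_left ((-1) ^ n)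
  calc _ = ∑' r : ℕ+, (((r : ℕ) : ℂ) ^ (n - 1) *
              (ellNome z * nome τ ^ (r : ℕ) / (1 - ellNome z * nome τ ^ (r : ℕ))) +
            (-1) ^ n * (((r : ℕ) : ℂ) ^ (n - 1) *
              ((ellNome z)⁻¹ * nome τ ^ (r : ℕ) / (1 - (ellNome z)⁻¹ * nome τ ^ (r : ℕ))))) :=
        tsum_congr fun r => by ring
    _ = _ := by
        rw [t1.tsum_add t2, tsum_mul_left, ← e1, ← e2, ← tsum_mul_left, ← s1.tsum_add s2]
        exact tsum_congr fun y => by ring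

lemma ellNome_ne_one {z : ℂ} {τ : ℍ} (hz : ∀ l u : ℤ, z ≠ l * τ + u) : ellNome z ≠ 1 := by
  intro h
  obtain ⟨u, hu⟩ := Complex.exp_eq_one_iff.mp h
  refine hz 0 u ?_
  have := Complex.two_pi_I_ne_zero
  rw [mul_comm (u : ℂ)] at hu
  simpa using mul_left_cancel₀ this hu

lemma one_sub_ne_zero {z : ℂ} {τ : ℍ} (hz : ∀ l u : ℤ, z ≠ l * τ + u) (r : ℕ) :
    1 - ellNome z * nome τ ^ r ≠ 0 := by
  intro h
  have h' : cexp (2 * π * I * (z + r * τ)) = 1 := by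
    rw [sub_eq_zero] at h
    rw [h, ellNome, nome, ← Complex.exp_nat_mul, ← Complex.exp_add]
    congr 1
    ring
  obtain ⟨u, hu⟩ := Complex.exp_eq_one_iff.mp h'
  rw [mul_comm (u : ℂ)] at hu
  refine hz (-r) u ?_
  have := mul_left_cancel₀ Complex.two_pi_I_ne_zero hu
  push_cast
  linear_combination this

lemma ellNome_neg (z : ℂ) : ellNome (-z) = (ellNome z)⁻¹ := by
  simp [ellNome, ← Complex.exp_neg]

lemma differentiable_ellNome : Differentiable ℂ ellNome := by
  unfold ellNome
  fun_prop

/-- The tail of the resummed series is holomorphic off the lattice. -/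
lemma differentiableAt_tsum (N : ℕ) (τ : ℍ) {z : ℂ} (hz : ∀ l u : ℤ, z ≠ l * τ + u) :
    (∀ᶠ w in nhds z, Summable fun r : ℕ+ => ((r : ℕ) : ℂ) ^ N *
      (ellNome w * nome τ ^ (r : ℕ) / (1 - ellNome w * nome τ ^ (r : ℕ)))) ∧
    DifferentiableAt ℂ (fun w => ∑' r : ℕ+, ((r : ℕ) : ℂ) ^ N *
      (ellNome w * nome τ ^ (r : ℕ) / (1 - ellNome w * nome τ ^ (r : ℕ)))) z := by
  set t : ℕ+ → ℂ → ℂ := fun r w => ((r : ℕ) : ℂ) ^ N *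
      (ellNome w * nome τ ^ (r : ℕ) / (1 - ellNome w * nome τ ^ (r : ℕ))) with ht
  set R : ℝ := ‖ellNome z‖ + 1 with hR
  have hRpos : 0 < R := by positivity
  have hcont : Continuous ellNome := differentiable_ellNome.continuous
  have htend := (tendsto_pow_atTop_nhds_zero_of_lt_one (norm_nonneg (nome τ))
    (norm_nome_lt_one τ)).const_mul R
  rw [mul_zero] at htend
  obtain ⟨M, hM⟩ := Filter.eventually_atTop.mp (htend.eventually_lt_const (half_pos one_pos))
  have hdiff : ∀ (r : ℕ+) (w : ℂ), 1 - ellNome w * nome τ ^ (r : ℕ) ≠ 0 →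
      DifferentiableAt ℂ (t r) w := by
    intro r w hw
    have := differentiable_ellNome w
    exact ((this.mul_const _).div ((this.mul_const _).const_sub 1) hw).const_mul _
  have hfin : {r : ℕ+ | (r : ℕ) < M}.Finite :=
    (Set.finite_lt_nat M).preimage PNat.coe_injective.injOn
  have ev1 : ∀ᶠ w in nhds z, ‖ellNome w‖ < R :=
    hcont.norm.continuousAt.eventually_lt_const (by simp [hR])
  have ev2 : ∀ᶠ w in nhds z, ∀ r ∈ {r : ℕ+ | (r : ℕ) < M},
      1 - ellNome w * nome τ ^ (r : ℕ) ≠ 0 ∧ ‖t r w‖ < ‖t r z‖ + 1 := by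
    rw [Filter.eventually_all_finite hfin]
    intro r _
    refine Filter.Eventually.and ?_ ?_
    · exact (by fun_prop : Continuous fun w => 1 - ellNome w * nome τ ^ (r : ℕ)).continuousAt.eventually_ne
        (one_sub_ne_zero hz r)
    · exact (hdiff r z (one_sub_ne_zero hz r)).continuousAt.norm.eventually_lt_const (by simp)
  obtain ⟨U, hU, hUo, hzU⟩ := eventually_nhds_iff.mp (ev1.and ev2)
  have key : ∀ w ∈ U, ∀ r : ℕ+, M ≤ (r : ℕ) → 1 / 2 ≤ ‖1 - ellNome w * nome τ ^ (r : ℕ)‖ := by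
    intro w hw r hr
    have h1 : ‖ellNome w * nome τ ^ (r : ℕ)‖ ≤ 1 / 2 := by
      rw [norm_mul, norm_pow]
      exact (mul_le_mul_of_nonneg_right (hU w hw).1.le (by positivity)).trans (hM r hr).le
    have h2 := norm_sub_norm_le (1 : ℂ) (ellNome w * nome τ ^ (r : ℕ))
    rw [norm_one] at h2
    linarith
  set u : ℕ+ → ℝ := fun r => (if (r : ℕ) < M then ‖t r z‖ + 1 else 0) +
    ((r : ℕ) : ℝ) ^ N * ‖nome τ‖ ^ (r : ℕ) * (2 * R) with hu
  have hsum : Summable u := by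
    refine Summable.add ?_ ((summable_pow_mul_norm_nome N τ).mul_right _)
    refine summable_of_hasFiniteSupport (hfin.subset ?_)
    intro r hr
    by_contra h
    exact hr (if_neg h)
  have hbound : ∀ (r : ℕ+) (w : ℂ), w ∈ U → ‖t r w‖ ≤ u r := by
    intro r w hw
    by_cases h : (r : ℕ) < M
    · simp only [hu, if_pos h]
      have := ((hU w hw).2 r h).2
      have h3 : 0 ≤ ((r : ℕ) : ℝ) ^ N * ‖nome τ‖ ^ (r : ℕ) * (2 * R) := by positivity
      linarith
    · simp only [hu, if_neg h, zero_add, ht, norm_mul, norm_pow, norm_div, Complex.norm_natCast]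
      have hk := key w hw r (not_lt.mp h)
      rw [mul_assoc (((r : ℕ) : ℝ) ^ N)]
      gcongr
      rw [div_le_iff₀ (by linarith)]
      have hle := (hU w hw).1.le
      have hq : 0 ≤ ‖nome τ‖ ^ (r : ℕ) := by positivity
      calc ‖ellNome w‖ * ‖nome τ‖ ^ (r : ℕ) ≤ ‖nome τ‖ ^ (r : ℕ) * (2 * R) * (1 / 2) := by
            nlinarith
        _ ≤ _ := by gcongr
  constructor
  · filter_upwards [hUo.mem_nhds hzU] with w hw
    exact Summable.of_norm_bounded hsum fun r => hbound r w hw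
  · refine (differentiableOn_tsum_of_summable_norm hsum ?_ hUo hbound).differentiableAt
      (hUo.mem_nhds hzU)
    intro r w hw
    refine (hdiff r w ?_).differentiableWithinAt
    by_cases h : (r : ℕ) < M
    · exact ((hU w hw).2 r h).1
    · intro h0
      have := key w hw r (not_lt.mp h)
      rw [h0, norm_zero] at this
      norm_num at this

/-- `J_n(·,τ)` is holomorphic off the lattice `ℤτ + ℤ`. -/
theorem differentiableAt_deformedEisenstein (n : ℕ) (τ : ℍ) {z : ℂ}
    (hz : ∀ l u : ℤ, z ≠ l * τ + u) :
    DifferentiableAt ℂ (fun w => deformedEisenstein n w τ) z := by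
  have hz' : ∀ l u : ℤ, -z ≠ l * τ + u := by
    intro l u h
    refine hz (-l) (-u) ?_
    push_cast
    linear_combination -h
  obtain ⟨s1, d1⟩ := differentiableAt_tsum (n - 1) τ hz
  obtain ⟨s2, d2⟩ := differentiableAt_tsum (n - 1) τ hz'
  have d2' := (DifferentiableAt.comp (g := fun w => ∑' r : ℕ+, ((r : ℕ) : ℂ) ^ (n - 1) *
      (ellNome w * nome τ ^ (r : ℕ) / (1 - ellNome w * nome τ ^ (r : ℕ)))) z d2
      differentiableAt_id.neg)
  have s2' := (continuous_neg (G := ℂ)).continuousAt.eventually s2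
  have hp : DifferentiableAt ℂ (fun w => if n = 1 then ellNome w / (ellNome w - 1) else 0) z := by
    split_ifs
    · exact (differentiable_ellNome z).div ((differentiable_ellNome z).sub_const 1)
        (sub_ne_zero.mpr (ellNome_ne_one hz))
    · exact differentiableAt_const _
  refine ((hp.add_const (bernoulli n : ℂ)).sub
    ((d1.add (d2'.const_mul ((-1) ^ n))).const_mul (n : ℂ))).congr_of_eventuallyEq ?_
  filter_upwards [s1, s2'] with w h1 h2
  simp only [deformedEisenstein, Pi.add_apply, Pi.sub_apply, Function.comp]
  rw [← tsum_mul_left (a := (-1 : ℂ) ^ n), ← h1.tsum_add (h2.mul_left _)]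
  congr 2
  refine tsum_congr fun r => ?_
  rw [ellNome_neg]
  ring

end JacobiSerre

end

/-! Write `c`, `d` for the lower row of `γ` and `j = cτ + d`. Two things must be shown: the
right-hand side obeys the transformation laws of weight `2k + 2` and index `m`, and it is
holomorphic with a Fourier expansion of the required shape.

Transformation laws. Differentiating the laws of `F` gives those of `F'`, `F^•`, `F^••` up to
anomalies. `J₁` and `J₂` satisfy `J₁(z+lτ+u) = J₁ - l`, `J₂(z+lτ+u) = J₂ - 2lJ₁ + l²`, together with
quasi-Jacobi modular laws (`deformedEisenstein_one_modular`, `deformedEisenstein_two_modular`). The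
modular laws hold because the difference of the two sides is doubly periodic with removable
singularities, hence constant by Liouville; the constant vanishes by oddness for `J₁` and by the
quasimodularity of `E₂` for `J₂`. In the sum, the anomaly of the bracket is `1 - 4m` times the
negative of what remains from `F' - (2k/12)E₂F`, so the factor `1/(1-4m)` cancels everything
(`serreSeries_elliptic`, `serreSeries_modular`).

Holomorphy and expansion. The weight is even, so `F` is even in `z` and `F^•(0,τ) = 0`, which
absorbs the pole of `J₁`. On the level of coefficients: for `0 < |Im z| < Im τ` the factor `p/(p-1)`
has different geometric expansions on the two sides of the real axis, but multiplied by `F^•` both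
give one Laurent series, since the coefficients of `F^•` have zero sum in each row
(`hasExpansion_div`). Its exponents satisfy `n + rs + ms² ≥ 0` for `0 ≤ s ≤ 1`. The elliptic law
makes the coefficients invariant under integer translations of `s`, so the inequality holds for all
real `s`, which is `r² ≤ 4nm` with `n ≥ 0` (`mem_jacobiCone_of_invariant`). A series with such
exponents converges on all of `ℂ × ℍ` and is jointly holomorphic, and by the identity theorem it
equals `∂^J F` off the lattice (`exists_coneSeries_eq_serreSeries`).

Value at `z = 0`. There `J₁F^•` tends to `F^••` and `J₂` to `E₂/6`, so the bracket vanishes and only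
the Serre derivative is left. -/

noncomputable section

namespace JacobiSerre

/-! ### Laurent monomials and Laurent expansions -/

/-- The Laurent monomial `p ^ r q ^ n` for `x = (n, r)`. -/
def mono (x : ℤ × ℤ) (z t : ℂ) : ℂ := cexp (2 * π * I * (x.1 * t + x.2 * z))

lemma mono_ne_zero (x : ℤ × ℤ) (z t : ℂ) : mono x z t ≠ 0 := Complex.exp_ne_zero _

lemma mono_add (x y : ℤ × ℤ) (z t : ℂ) : mono (x + y) z t = mono x z t * mono y z t := by
  simp only [mono, ← Complex.exp_add, Prod.fst_add, Prod.snd_add]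
  congr 1
  push_cast
  ring

@[simp] lemma mono_zero (z t : ℂ) : mono 0 z t = 1 := by simp [mono]

lemma norm_mono (x : ℤ × ℤ) (z t : ℂ) :
    ‖mono x z t‖ = Real.exp (-(2 * π * (x.1 * t.im + x.2 * z.im))) := by
  simp [mono, Complex.norm_exp]

lemma mono_eq_zpow (x : ℤ × ℤ) (z : ℂ) (τ : ℍ) :
    mono x z τ = ellNome z ^ x.2 * nome τ ^ x.1 := by
  simp only [mono, ellNome, nome, ← Complex.exp_int_mul, ← Complex.exp_add]
  congr 1
  ring

lemma mono_nat (n : ℕ) (r : ℤ) (z : ℂ) (τ : ℍ) :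
    mono (n, r) z τ = ellNome z ^ r * nome τ ^ n := by
  simp [mono_eq_zpow]

/-- `G` has on `R` an absolutely convergent Laurent expansion in `p` and `q`, whose exponents lie
in `K`. -/
def HasExpansion (R : Set (ℂ × ℍ)) (K : Set (ℤ × ℤ)) (G : ℂ → ℍ → ℂ) : Prop :=
  ∃ c : ℤ × ℤ → ℂ, (∀ x, c x ≠ 0 → x ∈ K) ∧
    ∀ z τ, (z, τ) ∈ R → HasSum (fun x => c x * mono x z τ) (G z τ)

variable {R : Set (ℂ × ℍ)} {K : Set (ℤ × ℤ)} {G : ℂ → ℍ → ℂ}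

/-- Sums over the fibres of `e` collect the terms with equal exponent. The resulting coefficients do
not depend on the point of `R`. -/
lemma HasExpansion.of_family {ι : Type*} (e : ι → ℤ × ℤ) (a : ι → ℂ)
    (he : ∀ i, a i ≠ 0 → e i ∈ K)
    (h : ∀ z τ, (z, τ) ∈ R → HasSum (fun i => a i * mono (e i) z τ) (G z τ)) :
    HasExpansion R K G := by
  refine ⟨fun x => ∑' i : e ⁻¹' {x}, a i, ?_, ?_⟩
  · intro x hx
    by_contra hK
    refine hx ?_
    have : ∀ i : e ⁻¹' {x}, a i = 0 := by
      rintro ⟨i, hi⟩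
      by_contra h0
      exact hK ((Set.mem_singleton_iff.mp hi) ▸ he i h0)
    simp [this]
  · intro z τ hz
    convert! (h z τ hz).tsum_fiberwise e using 2 with x
    rw [← tsum_mul_right]
    refine tsum_congr ?_
    rintro ⟨i, hi⟩
    rw [Set.mem_singleton_iff.mp hi]

lemma HasExpansion.mono_set {R' : Set (ℂ × ℍ)} {K' : Set (ℤ × ℤ)} (h : HasExpansion R K G)
    (hR : R' ⊆ R) (hK : K ⊆ K') : HasExpansion R' K' G := by
  obtain ⟨c, hc, hs⟩ := h
  exact ⟨c, fun x hx => hK (hc x hx), fun z τ hz => hs z τ (hR hz)⟩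

lemma HasExpansion.congr {G' : ℂ → ℍ → ℂ} (h : HasExpansion R K G)
    (hG : ∀ z τ, (z, τ) ∈ R → G' z τ = G z τ) : HasExpansion R K G' := by
  obtain ⟨c, hc, hs⟩ := h
  exact ⟨c, hc, fun z τ hz => by rw [hG z τ hz]; exact hs z τ hz⟩

lemma HasExpansion.add {G' : ℂ → ℍ → ℂ} (h : HasExpansion R K G) (h' : HasExpansion R K G') :
    HasExpansion R K (fun z τ => G z τ + G' z τ) := by
  obtain ⟨c, hc, hs⟩ := h
  obtain ⟨d, hd, hs'⟩ := h'
  refine ⟨fun x => c x + d x, fun x hx => ?_, fun z τ hz => ?_⟩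
  · by_contra hK
    refine hx ?_
    change c x + d x = 0
    rw [of_not_not fun h0 => hK (hc x h0), of_not_not fun h0 => hK (hd x h0), add_zero]
  · simpa only [add_mul] using (hs z τ hz).add (hs' z τ hz)

lemma HasExpansion.const_mul (a : ℂ) (h : HasExpansion R K G) :
    HasExpansion R K (fun z τ => a * G z τ) := by
  obtain ⟨c, hc, hs⟩ := h
  refine ⟨fun x => a * c x, fun x hx => hc x (right_ne_zero_of_mul hx), fun z τ hz => ?_⟩
  simpa only [mul_assoc] using (hs z τ hz).mul_left a

lemma HasExpansion.const (a : ℂ) (hK : (0 : ℤ × ℤ) ∈ K) :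
    HasExpansion R K (fun _ _ => a) := by
  refine .of_family (ι := Unit) (fun _ => 0) (fun _ => a) (fun _ _ => hK) fun z τ _ => ?_
  simp

lemma HasExpansion.mul {G' : ℂ → ℍ → ℂ} {K' K'' : Set (ℤ × ℤ)} (h : HasExpansion R K G)
    (h' : HasExpansion R K' G') (hK : ∀ x ∈ K, ∀ y ∈ K', x + y ∈ K'') :
    HasExpansion R K'' (fun z τ => G z τ * G' z τ) := by
  obtain ⟨c, hc, hs⟩ := h
  obtain ⟨d, hd, hs'⟩ := h'
  refine HasExpansion.of_family (ι := (ℤ × ℤ) × (ℤ × ℤ)) (fun i => i.1 + i.2)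
    (fun i => c i.1 * d i.2) ?_ ?_
  · intro i hi
    exact hK _ (hc _ (left_ne_zero_of_mul hi)) _ (hd _ (right_ne_zero_of_mul hi))
  · intro z τ hz
    have h1 := hs z τ hz
    have h2 := hs' z τ hz
    have h12 := summable_mul_of_summable_norm (f := fun x => c x * mono x z τ)
      (g := fun x => d x * mono x z τ) h1.summable.norm h2.summable.norm
    have h3 := h1.mul h2 h12
    refine h3.congr_fun fun i => ?_
    rw [mono_add]
    ring

/-! ### Uniqueness of Laurent coefficients -/

/-- Absolute summability gives uniform convergence on the circle, hence convergence in `L²`, where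
pairing with the `k`-th exponential isolates `a k`. -/
lemma eq_zero_of_fourier_hasSum_zero {a : ℤ → ℂ} (ha : Summable a)
    (h : ∀ x : ℝ, HasSum (fun n : ℤ => a n * cexp (2 * π * I * (n * x))) 0) (k : ℤ) : a k = 0 := by
  have hs : Summable fun n : ℤ => a n • (fourier n : C(AddCircle (1 : ℝ), ℂ)) := by
    refine Summable.of_norm ?_
    simpa [norm_smul, fourier_norm] using ha.norm
  have h0 : ∑' n : ℤ, a n • (fourier n : C(AddCircle (1 : ℝ), ℂ)) = 0 := by
    ext x
    induction x using QuotientAddGroup.induction_on with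
    | H x =>
      have h1 := (ContinuousMap.hasSum_apply hs.hasSum (x : AddCircle (1 : ℝ)))
      have h2 := h x
      refine h1.unique ?_
      convert! h2 using 2 with n
      simp only [ContinuousMap.smul_apply, smul_eq_mul, fourier_coe_apply, ofReal_one, div_one]
      congr 2
      ring
  have h3 := hs.hasSum
  rw [h0] at h3
  have h4 := h3.mapL (ContinuousMap.toLp (E := ℂ) 2 AddCircle.haarAddCircle ℂ)
  have h5 := h4.mapL (innerSL ℂ (fourierLp (T := 1) 2 k))
  rw [map_zero, map_zero] at h5
  have h6 : ∀ n, innerSL ℂ (fourierLp (T := 1) 2 k)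
      (ContinuousMap.toLp (E := ℂ) 2 AddCircle.haarAddCircle ℂ
        (a n • (fourier n : C(AddCircle (1 : ℝ), ℂ)))) = if n = k then a k else 0 := by
    intro n
    have := (orthonormal_iff_ite.mp (orthonormal_fourier (T := 1))) k n
    rw [map_smul, map_smul, innerSL_apply_apply, smul_eq_mul]
    change a n * inner ℂ _ (fourierLp 2 n) = _
    rw [this]
    split_ifs with h1 h2 h2
    · simp [h1]
    · exact absurd h1.symm h2
    · exact absurd h2.symm h1
    · simp
  simp only [h6] at h5
  exact (hasSum_ite_eq k (a k)).unique h5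

lemma mono_real_shift (x : ℤ × ℤ) (z t : ℂ) (s u : ℝ) :
    mono x (z + s) (t + u) =
      mono x z t * cexp (2 * π * I * (x.2 * s)) * cexp (2 * π * I * (x.1 * u)) := by
  simp only [mono, ← Complex.exp_add]
  congr 1
  ring

/-- A Laurent series vanishing on a real torus has zero coefficients. -/
lemma coeff_eq_zero {c : ℤ × ℤ → ℂ} {z t : ℂ}
    (h : ∀ s u : ℝ, HasSum (fun x => c x * mono x (z + s) (t + u)) 0) : c = 0 := by
  have hs : Summable fun x => c x * mono x z t := by
    simpa using (h 0 0).summable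
  have hs' : ∀ s : ℝ, Summable fun x : ℤ × ℤ =>
      c x * mono x z t * cexp (2 * π * I * (x.2 * s)) := by
    intro s
    have h1 := (h s 0).summable
    refine h1.congr fun x => ?_
    rw [mono_real_shift]
    simp [mul_assoc]
  -- Fourier uniqueness in the `τ`-direction separates the powers of `q`; a second application, in
  -- the `z`-direction, separates the powers of `p`.
  have h1 : ∀ (n : ℤ) (s : ℝ),
      ∑' r : ℤ, c (n, r) * mono (n, r) z t * cexp (2 * π * I * (r * s)) = 0 := by
    intro n s
    refine eq_zero_of_fourier_hasSum_zero
      (a := fun n => ∑' r : ℤ, c (n, r) * mono (n, r) z t * cexp (2 * π * I * (r * s)))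
      (hs' s).prod (fun u => ?_) n
    refine (h s u).prod_fiberwise fun n => ?_
    have h2 := ((hs' s).prod_factor n).hasSum.mul_right (cexp (2 * π * I * (n * u)))
    convert! h2 using 2 with r
    rw [mono_real_shift]
    ring
  funext ⟨n, r⟩
  have h2 := eq_zero_of_fourier_hasSum_zero (a := fun r => c (n, r) * mono (n, r) z t)
    (hs.prod_factor n) (fun s => by
      rw [← h1 n s]
      exact ((hs' s).prod_factor n).hasSum) r
  exact (mul_eq_zero.mp h2).resolve_right (mono_ne_zero _ _ _)

lemma coeff_unique {c d : ℤ × ℤ → ℂ} {z t : ℂ} (g : ℝ → ℝ → ℂ)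
    (hc : ∀ s u : ℝ, HasSum (fun x => c x * mono x (z + s) (t + u)) (g s u))
    (hd : ∀ s u : ℝ, HasSum (fun x => d x * mono x (z + s) (t + u)) (g s u)) : c = d := by
  refine sub_eq_zero.mp (coeff_eq_zero (z := z) (t := t) fun s u => ?_)
  simpa [sub_mul] using (hc s u).sub (hd s u)

/-! ### Laurent series with exponents in the Jacobi cone -/

/-- The exponents `(n, r)` with `n ≥ 0` and `r² ≤ 4nm`, described by the positivity of
`n + r s + m s²`. -/
def jacobiCone (m : ℕ) : Set (ℤ × ℤ) := {x | ∀ s : ℝ, 0 ≤ x.1 + x.2 * s + m * s ^ 2}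

lemma mem_jacobiCone_iff {m : ℕ} {x : ℤ × ℤ} :
    x ∈ jacobiCone m ↔ 0 ≤ x.1 ∧ x.2 ^ 2 ≤ 4 * x.1 * m := by
  constructor
  · intro h
    have h0 := h 0
    have h1 : discrim (m : ℝ) x.2 x.1 ≤ 0 :=
      discrim_le_zero fun s => by have := h s; nlinarith
    simp only [mul_zero, add_zero, ne_eq, OfNat.ofNat_ne_zero, not_false_eq_true, zero_pow] at h0
    rw [discrim] at h1
    refine ⟨by exact_mod_cast h0, ?_⟩
    have : ((x.2 : ℝ)) ^ 2 ≤ 4 * x.1 * m := by linarith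
    exact_mod_cast this
  · rintro ⟨h0, h1⟩ s
    have h0' : (0 : ℝ) ≤ x.1 := by exact_mod_cast h0
    have h1' : ((x.2 : ℝ)) ^ 2 ≤ 4 * x.1 * m := by exact_mod_cast h1
    rcases Nat.eq_zero_or_pos m with rfl | hm
    · have : (x.2 : ℝ) = 0 := by
        have : (x.2 : ℝ) ^ 2 ≤ 0 := by simpa using h1'
        exact pow_eq_zero_iff two_ne_zero |>.mp (le_antisymm this (sq_nonneg _))
      simp [this, h0']
    · have hm' : (0 : ℝ) < m := by exact_mod_cast hm
      have : 0 ≤ 4 * m * (x.1 + x.2 * s + m * s ^ 2) := by nlinarith [sq_nonneg (x.2 + 2 * m * s)]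
      exact nonneg_of_mul_nonneg_right this (by positivity)

lemma abs_snd_le {m : ℕ} {x : ℤ × ℤ} (hx : x ∈ jacobiCone m) : |(x.2 : ℝ)| ≤ x.1 + m := by
  have h1 := hx 1
  have h2 := hx (-1)
  rw [abs_le]
  constructor <;> linarith

/-- The cone inequality at `s = (Im z - Im z₀)/δ`, multiplied by `δ`: a gain of `δ` in `Im t` pays
for any bounded change of `Im z`, uniformly in the exponent. The majorants for cone series rest on
this. -/
lemma norm_mono_le {m : ℕ} {x : ℤ × ℤ} (hx : x ∈ jacobiCone m) {z t z₀ t₀ : ℂ} {δ Y : ℝ}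
    (hδ : 0 < δ) (ht : t₀.im + δ ≤ t.im) (hY : |z.im - z₀.im| ≤ Y) :
    ‖mono x z t‖ ≤ Real.exp (2 * π * (m * Y ^ 2 / δ)) * ‖mono x z₀ t₀‖ := by
  rw [norm_mono, norm_mono, ← Real.exp_add, Real.exp_le_exp]
  have h := hx ((z.im - z₀.im) / δ)
  have h0 := (mem_jacobiCone_iff.mp hx).1
  have h0' : (0 : ℝ) ≤ x.1 := by exact_mod_cast h0
  have h1 : 0 ≤ δ * (x.1 + x.2 * ((z.im - z₀.im) / δ) + m * ((z.im - z₀.im) / δ) ^ 2) := by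
    positivity
  have h2 : δ * (x.1 + x.2 * ((z.im - z₀.im) / δ) + m * ((z.im - z₀.im) / δ) ^ 2) =
      x.1 * δ + x.2 * (z.im - z₀.im) + m * (z.im - z₀.im) ^ 2 / δ := by
    field_simp
  rw [h2] at h1
  have h3 : m * (z.im - z₀.im) ^ 2 / δ ≤ m * Y ^ 2 / δ := by
    have := sq_le_sq.mpr (hY.trans (le_abs_self Y))
    gcongr
  have h4 : (x.1 : ℝ) * (t₀.im + δ) ≤ x.1 * t.im := mul_le_mul_of_nonneg_left ht h0'
  have h5 : 0 ≤ x.1 * t.im + x.2 * z.im + m * Y ^ 2 / δ - (x.1 * t₀.im + x.2 * z₀.im) := by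
    linarith
  have := mul_nonneg (mul_nonneg zero_le_two Real.pi_pos.le) h5
  linarith

/-- A Laurent series with exponents in the Jacobi cone, absolutely convergent on `ℂ × ℍ`. -/
structure IsConeSeries (m : ℕ) (c : ℤ × ℤ → ℂ) : Prop where
  supp : ∀ x, c x ≠ 0 → x ∈ jacobiCone m
  summable : ∀ z t : ℂ, 0 < t.im → Summable fun x => c x * mono x z t

/-- The sum of the Laurent series with coefficients `c`. -/
def laurentSum (c : ℤ × ℤ → ℂ) (z t : ℂ) : ℂ := ∑' x, c x * mono x z t

variable {m : ℕ} {c : ℤ × ℤ → ℂ}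

lemma norm_coeff_mul_mono_le (hc : ∀ x, c x ≠ 0 → x ∈ jacobiCone m) (x : ℤ × ℤ) {z t z₀ t₀ : ℂ}
    {δ Y : ℝ} (hδ : 0 < δ) (ht : t₀.im + δ ≤ t.im) (hY : |z.im - z₀.im| ≤ Y) :
    ‖c x * mono x z t‖ ≤ Real.exp (2 * π * (m * Y ^ 2 / δ)) * ‖c x * mono x z₀ t₀‖ := by
  by_cases h : c x = 0
  · simp [h]
  · rw [norm_mul, norm_mul, mul_left_comm]
    gcongr
    exact norm_mono_le (hc x h) hδ ht hY

/-- Convergence at one `z₀` above `t/2` dominates the series at every `z` above `t`, by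
`norm_mono_le`. -/
lemma IsConeSeries.of_exists (hc : ∀ x, c x ≠ 0 → x ∈ jacobiCone m)
    (hs : ∀ t : ℂ, 0 < t.im → ∃ z, Summable fun x => c x * mono x z t) : IsConeSeries m c := by
  refine ⟨hc, fun z t ht => ?_⟩
  have ht2 : 0 < ((t / 2 : ℂ)).im := by simpa using ht
  obtain ⟨z₀, h₀⟩ := hs (t / 2) ht2
  refine Summable.of_norm_bounded (h₀.norm.mul_left _)
    fun x => norm_coeff_mul_mono_le hc x ht2 (by simp) le_rfl

/-- Halving `Im t` absorbs the factor `n`: with `v = Im t / 2`, `2πnv ≤ exp(2πnv)`. -/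
lemma IsConeSeries.fst_mul (h : IsConeSeries m c) : IsConeSeries m fun x => x.1 * c x := by
  refine .of_exists (fun x hx => h.supp x (right_ne_zero_of_mul hx)) fun t ht => ⟨0, ?_⟩
  have ht2 : 0 < ((t / 2 : ℂ)).im := by simpa using ht
  refine Summable.of_norm_bounded ((h.summable 0 (t / 2) ht2).norm.mul_left
    ((2 * π * (t / 2).im)⁻¹)) fun x => ?_
  by_cases hx : c x = 0
  · simp [hx]
  have h0 : (0 : ℝ) ≤ x.1 := by exact_mod_cast (mem_jacobiCone_iff.mp (h.supp x hx)).1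
  rw [mul_assoc, norm_mul, norm_mul, norm_mul, mul_left_comm, mul_left_comm _ ‖c x‖]
  refine mul_le_mul_of_nonneg_left ?_ (norm_nonneg _)
  rw [norm_mono, norm_mono, Complex.norm_intCast, abs_of_nonneg h0, inv_mul_eq_div,
    le_div_iff₀ (by positivity)]
  set v := (t / 2).im with hv
  have htv : t.im = v + v := by simp [hv]
  simp only [htv, zero_im, mul_zero, add_zero]
  have h1 := Real.add_one_le_exp (2 * π * (x.1 * v))
  have h2 : Real.exp (-(2 * π * (x.1 * v))) =
      Real.exp (-(2 * π * (x.1 * (v + v)))) * Real.exp (2 * π * (x.1 * v)) := by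
    rw [← Real.exp_add]
    ring_nf
  rw [h2]
  have h3 := Real.exp_pos (-(2 * π * (x.1 * (v + v))))
  nlinarith

/-- In the cone `|r| ≤ n + m`, so this reduces to the factor `n`. -/
lemma IsConeSeries.snd_mul (h : IsConeSeries m c) : IsConeSeries m fun x => x.2 * c x := by
  refine ⟨fun x hx => h.supp x (right_ne_zero_of_mul hx), fun z t ht => ?_⟩
  refine Summable.of_norm_bounded
    ((h.fst_mul.summable z t ht).norm.add ((h.summable z t ht).norm.mul_left (m : ℝ))) fun x => ?_
  by_cases hx : c x = 0
  · simp [hx]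
  have h0 : (0 : ℝ) ≤ x.1 := by exact_mod_cast (mem_jacobiCone_iff.mp (h.supp x hx)).1
  have h1 := abs_snd_le (h.supp x hx)
  rw [mul_assoc, mul_assoc, norm_mul, norm_mul (x.1 : ℂ), ← add_mul, Complex.norm_intCast,
    Complex.norm_intCast, abs_of_nonneg h0]
  gcongr

lemma hasFDerivAt_mono (x : ℤ × ℤ) (y : ℂ × ℂ) :
    HasFDerivAt (fun y : ℂ × ℂ => mono x y.1 y.2)
      ((2 * π * I * mono x y.1 y.2) • ((x.1 : ℂ) • ContinuousLinearMap.snd ℂ ℂ ℂ +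
        (x.2 : ℂ) • ContinuousLinearMap.fst ℂ ℂ ℂ)) y := by
  have h := (((hasFDerivAt_snd (𝕜 := ℂ) (p := y)).const_mul (x.1 : ℂ)).add
    ((hasFDerivAt_fst (𝕜 := ℂ) (p := y)).const_mul (x.2 : ℂ))).const_mul (2 * π * I)
  convert! h.cexp using 1
  rw [mono, smul_smul, mul_comm]
  rfl

/-- A cone series is jointly holomorphic and may be differentiated termwise. -/
theorem IsConeSeries.hasFDerivAt (h : IsConeSeries m c) (y : ℂ × ℂ) (hy : 0 < y.2.im) :
    HasFDerivAt (fun y : ℂ × ℂ => laurentSum c y.1 y.2)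
      ((2 * π * I * laurentSum (fun x => x.1 * c x) y.1 y.2) • ContinuousLinearMap.snd ℂ ℂ ℂ +
        (2 * π * I * laurentSum (fun x => x.2 * c x) y.1 y.2) • ContinuousLinearMap.fst ℂ ℂ ℂ)
      y := by
  set s : Set (ℂ × ℂ) := {w | |w.1.im - y.1.im| < 1 ∧ y.2.im / 2 < w.2.im} with hs
  have hso : IsOpen s := by
    have h1 : Continuous fun w : ℂ × ℂ => |w.1.im - y.1.im| := by fun_prop
    have h2 : Continuous fun w : ℂ × ℂ => w.2.im := by fun_prop
    exact (isOpen_lt h1 continuous_const).inter (isOpen_lt continuous_const h2)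
  have hsc : Convex ℝ s := by
    refine Convex.inter ?_ ?_
    · exact (convex_ball y.1.im 1).is_linear_preimage
        (IsLinearMap.mk (f := fun w : ℂ × ℂ => w.1.im) (by simp) (by simp))
    · exact (convex_Ioi (y.2.im / 2)).is_linear_preimage
        (IsLinearMap.mk (f := fun w : ℂ × ℂ => w.2.im) (by simp) (by simp))
  have hys : y ∈ s := ⟨by simp, by linarith⟩
  -- Points of `s` have height above `Im y.2 / 2`; comparison at a quarter of the height leaves `δ =
  -- Im y.2 / 4` for the uniform bound.
  set t₀ : ℂ := (y.2.im / 4 : ℝ) * I with ht₀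
  have ht₀im : t₀.im = y.2.im / 4 := by simp [ht₀]
  have ht₀pos : 0 < t₀.im := by rw [ht₀im]; linarith
  set C : ℝ := Real.exp (2 * π * (m * 1 ^ 2 / (y.2.im / 4))) with hC
  have hn := h.fst_mul.summable y.1 t₀ ht₀pos
  have hr := h.snd_mul.summable y.1 t₀ ht₀pos
  have hu : Summable fun x : ℤ × ℤ => 2 * π * C * (‖(x.1 : ℂ) * c x * mono x y.1 t₀‖ +
      ‖(x.2 : ℂ) * c x * mono x y.1 t₀‖) := (hn.norm.add hr.norm).mul_left _
  have hf : ∀ (x : ℤ × ℤ) (w : ℂ × ℂ), w ∈ s → HasFDerivAt (fun w => c x * mono x w.1 w.2)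
      ((2 * π * I) • ((x.1 * c x * mono x w.1 w.2) • ContinuousLinearMap.snd ℂ ℂ ℂ +
          (x.2 * c x * mono x w.1 w.2) • ContinuousLinearMap.fst ℂ ℂ ℂ)) w := by
    intro x w _
    refine ((hasFDerivAt_mono x w).const_mul (c x)).congr_fderiv ?_
    simp only [smul_add, smul_smul]
    congr 2 <;> ring
  have key := hasFDerivAt_tsum_of_isPreconnected hu hso hsc.isPreconnected hf ?_ hys
    (h.summable y.1 y.2 hy) hys
  · have hn' := (h.fst_mul.summable y.1 y.2 hy).hasSum.mul_left (2 * π * I)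
    have hr' := (h.snd_mul.summable y.1 y.2 hy).hasSum.mul_left (2 * π * I)
    have h1 := (hn'.smul_const (ContinuousLinearMap.snd ℂ ℂ ℂ)).add
      (hr'.smul_const (ContinuousLinearMap.fst ℂ ℂ ℂ))
    refine key.congr_fderiv ?_
    rw [laurentSum, laurentSum, ← h1.tsum_eq]
    refine tsum_congr fun x => ?_
    simp only [smul_add, smul_smul]
  · rintro x w ⟨hw1, hw2⟩
    have ht : t₀.im + y.2.im / 4 ≤ w.2.im := by rw [ht₀im]; linarith
    have hb1 := norm_coeff_mul_mono_le h.fst_mul.supp x (δ := y.2.im / 4) (by linarith) ht hw1.le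
    have hb2 := norm_coeff_mul_mono_le h.snd_mul.supp x (δ := y.2.im / 4) (by linarith) ht hw1.le
    have hfst := ContinuousLinearMap.norm_fst_le ℂ ℂ ℂ
    have hsnd := ContinuousLinearMap.norm_snd_le ℂ ℂ ℂ
    rw [norm_smul]
    have h2pi : ‖(2 * π * I : ℂ)‖ = 2 * π := by simp [Real.pi_pos.le]
    rw [h2pi, mul_assoc (2 * π)]
    gcongr
    refine (norm_add_le _ _).trans ?_
    rw [norm_smul, norm_smul, mul_add]
    refine add_le_add ?_ ?_
    · exact (mul_le_of_le_one_right (norm_nonneg _) hsnd).trans hb1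
    · exact (mul_le_of_le_one_right (norm_nonneg _) hfst).trans hb2

lemma IsConeSeries.hasDerivAt_fst (h : IsConeSeries m c) (z t : ℂ) (ht : 0 < t.im) :
    HasDerivAt (fun w => laurentSum c w t)
      (2 * π * I * laurentSum (fun x => x.2 * c x) z t) z := by
  have h1 := (h.hasFDerivAt (z, t) ht).comp_hasDerivAt z
    ((hasDerivAt_id z).prodMk (hasDerivAt_const z t))
  simpa using! h1

lemma IsConeSeries.hasDerivAt_snd (h : IsConeSeries m c) (z t : ℂ) (ht : 0 < t.im) :
    HasDerivAt (fun w => laurentSum c z w)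
      (2 * π * I * laurentSum (fun x => x.1 * c x) z t) t := by
  have h1 := (h.hasFDerivAt (z, t) ht).comp_hasDerivAt t
    ((hasDerivAt_const t z).prodMk (hasDerivAt_id t))
  simpa using! h1

lemma IsConeSeries.differentiable_fst (h : IsConeSeries m c) (τ : ℍ) :
    Differentiable ℂ fun z => laurentSum c z τ :=
  fun z => (h.hasDerivAt_fst z τ τ.im_pos).differentiableAt

lemma IsConeSeries.hasSum (h : IsConeSeries m c) (z : ℂ) (τ : ℍ) :
    HasSum (fun x => c x * mono x z τ) (laurentSum c z τ) :=
  (h.summable z τ τ.im_pos).hasSum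

lemma IsConeSeries.zDeriv (h : IsConeSeries m c) :
    zDeriv (fun z (τ : ℍ) => laurentSum c z τ) = fun z (τ : ℍ) => laurentSum (fun x => x.2 * c x) z τ := by
  funext z τ
  rw [JacobiSerre.zDeriv, (h.hasDerivAt_fst z τ τ.im_pos).deriv,
    inv_mul_cancel_left₀ Complex.two_pi_I_ne_zero]

lemma IsConeSeries.tauDeriv (h : IsConeSeries m c) :
    tauDeriv (fun z (τ : ℍ) => laurentSum c z τ) = fun z (τ : ℍ) => laurentSum (fun x => x.1 * c x) z τ := by
  funext z τ
  have h1 : HasDerivAt ((fun τ : ℍ => laurentSum c z τ) ∘ ofComplex)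
      (2 * π * I * laurentSum (fun x => x.1 * c x) z τ) τ := by
    refine (h.hasDerivAt_snd z τ τ.im_pos).congr_of_eventuallyEq ?_
    filter_upwards [isOpen_upperHalfPlaneSet.mem_nhds τ.im_pos] with w hw
    simp [ofComplex_apply_of_im_pos hw]
  rw [JacobiSerre.tauDeriv, Derivative.normalizedDerivOfComplex, h1.deriv,
    inv_mul_cancel_left₀ Complex.two_pi_I_ne_zero]

lemma IsConeSeries.differentiableOn (h : IsConeSeries m c) :
    DifferentiableOn ℂ (fun x : ℂ × ℂ => laurentSum c x.1 (ofComplex x.2)) {x | 0 < x.2.im} := by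
  intro y hy
  refine ((h.hasFDerivAt y hy).differentiableAt.differentiableWithinAt).congr ?_ ?_
  · intro w hw
    rw [ofComplex_apply_of_im_pos hw]
  · rw [ofComplex_apply_of_im_pos hy]

/-- Jacobi forms are cone series. -/
lemma IsJacobiForm.exists_coneSeries {k : ℤ} {F : ℂ → ℍ → ℂ} (hF : IsJacobiForm k m F) :
    ∃ c, IsConeSeries m c ∧ F = fun z (τ : ℍ) => laurentSum c z τ := by
  obtain ⟨c, hc, hs⟩ := hF.fourier
  let e : ℕ × ℤ → ℤ × ℤ := fun x => (x.1, x.2)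
  have he : Function.Injective e := by
    rintro ⟨a, b⟩ ⟨a', b'⟩ h
    simpa [e] using h
  let d : ℤ × ℤ → ℂ := fun x => if 0 ≤ x.1 then c x.1.toNat x.2 else 0
  have hd : ∀ z τ, HasSum (fun x => d x * mono x z (τ : ℍ)) (F z τ) := by
    intro z τ
    refine (he.hasSum_iff ?_).mp ((hs z τ).congr_fun ?_)
    · rintro ⟨n, r⟩ hx
      have : ¬ 0 ≤ n := fun h => hx ⟨(n.toNat, r), by simp [e, h]⟩
      simp [d, this]
    · rintro ⟨n, r⟩
      simp [d, e, mono_nat, mul_assoc]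
  refine ⟨d, ⟨?_, fun z t ht => (hd z ⟨t, ht⟩).summable⟩, ?_⟩
  · rintro ⟨n, r⟩ hx
    rw [mem_jacobiCone_iff]
    have hn : 0 ≤ n := by
      by_contra h
      exact hx (by simp [d, h])
    refine ⟨hn, ?_⟩
    by_contra h
    refine hx ?_
    simp only [d, hn, if_true]
    refine hc _ _ ?_
    rw [Int.toNat_of_nonneg hn]
    simpa using h
  · funext z τ
    exact (hd z τ).tsum_eq.symm

/-- Cone series have the Fourier expansion of a Jacobi form. -/
lemma IsConeSeries.fourier (h : IsConeSeries m c) :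
    ∃ d : ℕ → ℤ → ℂ, (∀ (n : ℕ) (r : ℤ), 4 * (n : ℤ) * m < r ^ 2 → d n r = 0) ∧
      ∀ (z : ℂ) (τ : ℍ),
        HasSum (fun x : ℕ × ℤ => d x.1 x.2 * ellNome z ^ x.2 * nome τ ^ x.1)
          (laurentSum c z τ) := by
  let e : ℕ × ℤ → ℤ × ℤ := fun x => (x.1, x.2)
  have he : Function.Injective e := by
    rintro ⟨a, b⟩ ⟨a', b'⟩ h
    simpa [e] using h
  refine ⟨fun n r => c (n, r), fun n r hr => ?_, fun z τ => ?_⟩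
  · by_contra h0
    exact absurd (mem_jacobiCone_iff.mp (h.supp _ h0)).2 (not_le.mpr hr)
  · refine ((he.hasSum_iff ?_).mpr (h.hasSum z τ)).congr_fun ?_
    · rintro ⟨n, r⟩ hx
      by_contra h0
      have := (mem_jacobiCone_iff.mp (h.supp _ (left_ne_zero_of_mul h0))).1
      exact hx ⟨(n.toNat, r), by simpa [e] using this⟩
    · rintro ⟨n, r⟩
      simp [e, mono_nat, mul_assoc]

/-! ### The period lattice -/

/-- The complement of the lattice `ℤτ + ℤ`. -/
def offLattice (τ : ℍ) : Set ℂ := {z | ∀ l u : ℤ, z ≠ l * τ + u}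

lemma offLattice_add {τ : ℍ} {z : ℂ} (hz : z ∈ offLattice τ) (l u : ℤ) :
    z + l * τ + u ∈ offLattice τ := by
  intro l' u' h
  refine hz (l' - l) (u' - u) ?_
  push_cast
  linear_combination h

lemma offLattice_neg {τ : ℍ} {z : ℂ} (hz : z ∈ offLattice τ) : -z ∈ offLattice τ := by
  intro l u h
  refine hz (-l) (-u) ?_
  push_cast
  linear_combination -h

/-- The coordinates of `z` with respect to the real basis `τ, 1` of `ℂ`. -/
def latCoord (τ : ℍ) (z : ℂ) : ℝ × ℝ := (z.im / τ.im, z.re - z.im / τ.im * τ.re)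

lemma continuous_latCoord (τ : ℍ) : Continuous (latCoord τ) := by
  unfold latCoord
  fun_prop

lemma latCoord_spec (τ : ℍ) (z : ℂ) :
    z = ((latCoord τ z).1 : ℂ) * τ + ((latCoord τ z).2 : ℂ) := by
  have := τ.im_pos.ne'
  apply Complex.ext
  · simp [latCoord]
  · simp [latCoord, this]

lemma latCoord_combo (τ : ℍ) (a b : ℝ) : latCoord τ (a * τ + b) = (a, b) := by
  have := τ.im_pos.ne'
  simp [latCoord, this]

lemma mem_offLattice_iff {τ : ℍ} {z : ℂ} :
    z ∈ offLattice τ ↔ latCoord τ z ∉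
      Set.range ((↑) : ℤ → ℝ) ×ˢ Set.range ((↑) : ℤ → ℝ) := by
  constructor
  · rintro h ⟨⟨l, hl⟩, ⟨u, hu⟩⟩
    refine h l u ?_
    conv_lhs => rw [latCoord_spec τ z, ← hl, ← hu]
    push_cast
    rfl
  · intro h l u hz
    refine h ?_
    have := latCoord_combo τ l u
    push_cast at this
    rw [hz, this]
    exact ⟨⟨l, rfl⟩, ⟨u, rfl⟩⟩

lemma isOpen_offLattice (τ : ℍ) : IsOpen (offLattice τ) := by
  have h : IsClosed (Set.range ((↑) : ℤ → ℝ) ×ˢ Set.range ((↑) : ℤ → ℝ)) :=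
    Int.isClosedEmbedding_coe_real.isClosed_range.prod Int.isClosedEmbedding_coe_real.isClosed_range
  have := (h.preimage (continuous_latCoord τ)).isOpen_compl
  convert! this using 1
  ext z
  exact mem_offLattice_iff

lemma countable_compl_offLattice (τ : ℍ) : (offLattice τ)ᶜ.Countable := by
  refine (Set.countable_range fun x : ℤ × ℤ => (x.1 * τ + x.2 : ℂ)).mono ?_
  intro z hz
  simp only [offLattice, Set.mem_compl_iff, Set.mem_ofPred_eq, not_forall, not_not] at hz
  obtain ⟨l, u, h⟩ := hz
  exact ⟨(l, u), h.symm⟩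

lemma dense_offLattice (τ : ℍ) : Dense (offLattice τ) := by
  have := (countable_compl_offLattice τ).dense_compl ℝ
  rwa [compl_compl] at this

lemma isPreconnected_offLattice (τ : ℍ) : IsPreconnected (offLattice τ) := by
  have := ((countable_compl_offLattice τ).isConnected_compl_of_one_lt_rank (by simp)).isPreconnected
  rwa [compl_compl] at this

lemma eventually_offLattice (τ : ℍ) : ∀ᶠ z in nhdsWithin (0 : ℂ) {0}ᶜ, z ∈ offLattice τ := by
  rw [eventually_nhdsWithin_iff]
  have h0 : latCoord τ 0 = (0, 0) := by simp [latCoord]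
  have hc := (continuous_latCoord τ).continuousAt (x := 0)
  have h1 : ∀ᶠ z in nhds (0 : ℂ), |(latCoord τ z).1| < 1 :=
    hc.fst.abs.eventually_lt_const (by simp [h0])
  have h2 : ∀ᶠ z in nhds (0 : ℂ), |(latCoord τ z).2| < 1 :=
    hc.snd.abs.eventually_lt_const (by simp [h0])
  filter_upwards [h1, h2] with z hz1 hz2 hz l u h
  have := latCoord_combo τ l u
  push_cast at this
  rw [h, this] at hz1 hz2
  dsimp only at hz1 hz2
  have hl : l = 0 := by
    have : |l| < 1 := by exact_mod_cast hz1
    rwa [Int.abs_lt_one_iff] at this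
  have hu : u = 0 := by
    have : |u| < 1 := by exact_mod_cast hz2
    rwa [Int.abs_lt_one_iff] at this
  exact hz (by simp [h, hl, hu])

/-- Functions continuous in `z` that agree off the lattice are equal. -/
lemma eq_of_eqOn_offLattice {τ : ℍ} {f g : ℂ → ℂ} (hf : Continuous f) (hg : Continuous g)
    (h : ∀ z ∈ offLattice τ, f z = g z) (z : ℂ) : f z = g z :=
  congrFun (hf.ext_on (dense_offLattice τ) hg h) z

/-- Liouville's theorem for doubly periodic functions with at most a removable singularity at the
lattice points. -/
theorem eq_const_of_doublyPeriodic {τ : ℍ} {f : ℂ → ℂ}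
    (hd : ∀ z ∈ offLattice τ, DifferentiableAt ℂ f z)
    (h1 : ∀ z ∈ offLattice τ, f (z + 1) = f z) (hτ : ∀ z ∈ offLattice τ, f (z + τ) = f z)
    (h0 : Filter.Tendsto (fun z => z * f z) (nhdsWithin 0 {0}ᶜ) (nhds 0)) :
    ∃ L, ∀ z ∈ offLattice τ, f z = L := by
  classical
  set L := (nhdsWithin (0 : ℂ) {0}ᶜ).limUnder f with hL
  have hlim : Filter.Tendsto f (nhdsWithin 0 {0}ᶜ) (nhds L) := by
    refine Complex.tendsto_limUnder_of_differentiable_on_punctured_nhds_of_isLittleO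
      ((eventually_offLattice τ).mono hd) ?_
    rw [Asymptotics.isLittleO_iff_tendsto']
    · have h2 : Filter.Tendsto (fun z : ℂ => z * f 0) (nhdsWithin 0 {0}ᶜ) (nhds 0) := by
        have : Filter.Tendsto (fun z : ℂ => z * f 0) (nhds 0) (nhds (0 * f 0)) :=
          (continuous_id.mul continuous_const).tendsto 0
        rw [zero_mul] at this
        exact this.mono_left nhdsWithin_le_nhds
      have h3 := h0.sub h2
      rw [sub_zero] at h3
      refine h3.congr fun z => ?_
      rw [sub_zero, div_inv_eq_mul]
      ring
    · filter_upwards [self_mem_nhdsWithin] with z hz h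
      simp only [sub_zero, inv_eq_zero] at h
      exact absurd h hz
  -- Giving all lattice points the same value `L` keeps `g` periodic, so differentiability at `0`
  -- carries over to the whole lattice.
  set g : ℂ → ℂ := fun z => if z ∈ offLattice τ then f z else L with hg
  have hg_off : ∀ z ∈ offLattice τ, g z = f z := fun z hz => if_pos hz
  have hgd : ∀ z ∈ offLattice τ, DifferentiableAt ℂ g z := by
    intro z hz
    refine (hd z hz).congr_of_eventuallyEq ?_
    filter_upwards [(isOpen_offLattice τ).mem_nhds hz] with w hw
    exact hg_off w hw
  have hper : ∀ (w : ℂ) (_ : ∃ l u : ℤ, w = l * τ + u), (∀ z ∈ offLattice τ, f (z + w) = f z) →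
      Function.Periodic g w := by
    rintro w ⟨l, u, rfl⟩ hw z
    by_cases hz : z ∈ offLattice τ
    · have := offLattice_add hz l u
      rw [add_assoc] at this
      rw [hg_off _ this, hg_off _ hz, hw z hz]
    · have : z + (l * τ + u) ∉ offLattice τ := by
        intro h
        have := offLattice_add h (-l) (-u)
        push_cast at this
        exact hz (by convert! this using 1; ring)
      simp only [hg, if_neg hz, if_neg this]
  have hg1 : Function.Periodic g 1 := hper 1 ⟨0, 1, by simp⟩ h1
  have hgτ : Function.Periodic g τ := hper τ ⟨1, 0, by simp⟩ hτ
  have hzero : (0 : ℂ) ∉ offLattice τ := fun h => h 0 0 (by simp)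
  have hg0 : DifferentiableAt ℂ g 0 := by
    refine (Complex.analyticAt_of_differentiable_on_punctured_nhds_of_continuousAt
      ((eventually_offLattice τ).mono hgd) ?_).differentiableAt
    rw [← continuousWithinAt_compl_self, ContinuousWithinAt]
    have : g 0 = L := if_neg hzero
    rw [this]
    refine hlim.congr' ?_
    filter_upwards [eventually_offLattice τ] with z hz
    exact (hg_off z hz).symm
  have hgdiff : Differentiable ℂ g := by
    intro z
    by_cases hz : z ∈ offLattice τ
    · exact hgd z hz
    · simp only [offLattice, Set.mem_ofPred_eq, not_forall, not_not] at hz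
      obtain ⟨l, u, rfl⟩ := hz
      have hp : ∀ w, g w = g (w - (l * τ + u)) := by
        intro w
        have h1 := hgτ.int_mul l (w - (l * τ + u))
        have h2 := hg1.int_mul u (w - (l * τ + u) + l * τ)
        rw [← h1, ← h2]
        congr 1
        ring
      have e : g = g ∘ fun w => w - (l * τ + u) := funext hp
      rw [e]
      refine DifferentiableAt.comp _ ?_ (by fun_prop)
      rwa [sub_self]
  -- By periodicity all values are taken on the compact period parallelogram.
  have hb : Bornology.IsBounded (Set.range g) := by
    set K : Set ℂ := (fun x : ℝ × ℝ => (x.1 * τ + x.2 : ℂ)) '' (Set.Icc 0 1 ×ˢ Set.Icc 0 1) with hK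
    have hKc : IsCompact K := (isCompact_Icc.prod isCompact_Icc).image (by fun_prop)
    refine (hKc.image hgdiff.continuous).isBounded.subset ?_
    rintro _ ⟨z, rfl⟩
    set a := (latCoord τ z).1
    set b := (latCoord τ z).2
    refine ⟨(Int.fract a : ℝ) * τ + (Int.fract b : ℝ), ⟨(Int.fract a, Int.fract b),
      ⟨⟨Int.fract_nonneg a, (Int.fract_lt_one a).le⟩, ⟨Int.fract_nonneg b, (Int.fract_lt_one b).le⟩⟩,
      rfl⟩, ?_⟩
    have h1 := hgτ.int_mul ⌊a⌋ ((Int.fract a : ℝ) * τ + (Int.fract b : ℝ))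
    have h2 := hg1.int_mul ⌊b⌋ ((Int.fract a : ℝ) * τ + (Int.fract b : ℝ) + ⌊a⌋ * τ)
    rw [← h1, ← h2]
    congr 1
    conv_rhs => rw [latCoord_spec τ z]
    simp only [Int.fract, ofReal_sub, ofReal_intCast, a, b]
    ring
  refine ⟨g 0, fun z hz => ?_⟩
  rw [← hg_off z hz]
  exact hgdiff.apply_eq_apply_of_bounded hb z 0

/-! ### Lambert series and the functions `J₁`, `J₂` -/

/-- The summand `r ^ N · x q ^ r / (1 - x q ^ r)`. -/
def lambertTerm (N : ℕ) (τ : ℍ) (x : ℂ) (r : ℕ) : ℂ :=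
  (r : ℂ) ^ N * (x * nome τ ^ r / (1 - x * nome τ ^ r))

/-- The Lambert series `∑_{r ≥ 1} r ^ N · x q ^ r / (1 - x q ^ r)`. -/
def lambertSum (N : ℕ) (τ : ℍ) (x : ℂ) : ℂ := ∑' r : ℕ+, lambertTerm N τ x r

lemma summable_lambertTerm {τ : ℍ} {z : ℂ} (hz : z ∈ offLattice τ) (N : ℕ) :
    Summable fun r : ℕ+ => lambertTerm N τ (ellNome z) r :=
  (differentiableAt_tsum N τ hz).1.self_of_nhds

lemma deformedEisenstein_one_of_summable {τ : ℍ} {z : ℂ}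
    (h1 : Summable fun r : ℕ+ => lambertTerm 0 τ (ellNome z) r)
    (h2 : Summable fun r : ℕ+ => lambertTerm 0 τ (ellNome z)⁻¹ r) :
    deformedEisenstein 1 z τ = ellNome z / (ellNome z - 1) - 1 / 2 -
      (lambertSum 0 τ (ellNome z) - lambertSum 0 τ (ellNome z)⁻¹) := by
  rw [lambertSum, lambertSum, ← h1.tsum_sub h2, deformedEisenstein]
  simp only [if_true, bernoulli_one, Nat.cast_one, one_mul, lambertTerm, pow_zero, pow_one,
    Nat.sub_self, neg_mul, ← sub_eq_add_neg]
  push_cast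
  ring

lemma deformedEisenstein_two_of_summable {τ : ℍ} {z : ℂ}
    (h1 : Summable fun r : ℕ+ => lambertTerm 1 τ (ellNome z) r)
    (h2 : Summable fun r : ℕ+ => lambertTerm 1 τ (ellNome z)⁻¹ r) :
    deformedEisenstein 2 z τ = 1 / 6 - 2 *
      (lambertSum 1 τ (ellNome z) + lambertSum 1 τ (ellNome z)⁻¹) := by
  rw [lambertSum, lambertSum, ← h1.tsum_add h2, deformedEisenstein]
  have : bernoulli 2 = 1 / 6 := by
    rw [bernoulli_eq_bernoulli'_of_ne_one (by norm_num), bernoulli'_two]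
  simp only [this, lambertTerm, ← mul_add]
  norm_num

lemma deformedEisenstein_one {τ : ℍ} {z : ℂ} (hz : z ∈ offLattice τ) :
    deformedEisenstein 1 z τ = ellNome z / (ellNome z - 1) - 1 / 2 -
      (lambertSum 0 τ (ellNome z) - lambertSum 0 τ (ellNome z)⁻¹) :=
  deformedEisenstein_one_of_summable (summable_lambertTerm hz 0)
    (ellNome_neg z ▸ summable_lambertTerm (offLattice_neg hz) 0)

lemma deformedEisenstein_two {τ : ℍ} {z : ℂ} (hz : z ∈ offLattice τ) :
    deformedEisenstein 2 z τ = 1 / 6 - 2 *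
      (lambertSum 1 τ (ellNome z) + lambertSum 1 τ (ellNome z)⁻¹) :=
  deformedEisenstein_two_of_summable (summable_lambertTerm hz 1)
    (ellNome_neg z ▸ summable_lambertTerm (offLattice_neg hz) 1)

lemma ellNome_ne_zero (z : ℂ) : ellNome z ≠ 0 := Complex.exp_ne_zero _

lemma nome_ne_zero (τ : ℍ) : nome τ ≠ 0 := Complex.exp_ne_zero _

/-- `p/(p-1) - 1/2` is odd, and the two Lambert series are exchanged by `p ↦ p⁻¹`. -/
lemma deformedEisenstein_one_neg {τ : ℍ} {z : ℂ} (hz : z ∈ offLattice τ) :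
    deformedEisenstein 1 (-z) τ = -deformedEisenstein 1 z τ := by
  rw [deformedEisenstein_one hz, deformedEisenstein_one (offLattice_neg hz), ellNome_neg, inv_inv]
  have h1 := ellNome_ne_zero z
  have h2 : ellNome z - 1 ≠ 0 := sub_ne_zero.mpr (ellNome_ne_one hz)
  have h3 : (ellNome z)⁻¹ / ((ellNome z)⁻¹ - 1) = 1 - ellNome z / (ellNome z - 1) := by
    have h4 : 1 - ellNome z ≠ 0 := by rw [← neg_sub]; exact neg_ne_zero.mpr h2
    have h5 : (ellNome z)⁻¹ - 1 = (1 - ellNome z) / ellNome z := by field_simp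
    rw [h5]
    field_simp
    ring
  rw [h3]
  ring

lemma lambertSum_eq_tsum_nat (N : ℕ) (τ : ℍ) (x : ℂ) :
    lambertSum N τ x = ∑' n : ℕ, lambertTerm N τ x (n + 1) :=
  tsum_pnat_eq_tsum_succ (f := lambertTerm N τ x)

lemma lambertTerm_mul_nome (τ : ℍ) (x : ℂ) (r : ℕ) :
    lambertTerm 0 τ (x * nome τ) r = lambertTerm 0 τ x (r + 1) := by
  simp only [lambertTerm, pow_zero, one_mul, pow_succ' (nome τ) r, mul_assoc]

/-- Replacing `x` by `xq` shifts the index by one, so only the `r = 1` term is lost. -/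
lemma lambertSum_zero_mul_nome {τ : ℍ} {x : ℂ}
    (h : Summable fun r : ℕ+ => lambertTerm 0 τ x r) :
    lambertSum 0 τ (x * nome τ) = lambertSum 0 τ x - x * nome τ / (1 - x * nome τ) := by
  have hs : Summable fun n : ℕ => lambertTerm 0 τ x (n + 1) :=
    (summable_pnat_iff_summable_succ (f := lambertTerm 0 τ x)).mp h
  rw [lambertSum_eq_tsum_nat, lambertSum_eq_tsum_nat, hs.tsum_eq_zero_add]
  simp only [lambertTerm_mul_nome]
  simp [lambertTerm]

/-- After the index shift the weight `r` becomes `r - 1`. There is no boundary term: the weighted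
and unweighted terms agree at `r = 1`. -/
lemma lambertSum_one_mul_nome {τ : ℍ} {x : ℂ}
    (h0 : Summable fun r : ℕ+ => lambertTerm 0 τ x r)
    (h1 : Summable fun r : ℕ+ => lambertTerm 1 τ x r) :
    lambertSum 1 τ (x * nome τ) = lambertSum 1 τ x - lambertSum 0 τ x := by
  have hs0 : Summable fun n : ℕ => lambertTerm 0 τ x (n + 1) :=
    (summable_pnat_iff_summable_succ (f := lambertTerm 0 τ x)).mp h0
  have hs1 : Summable fun n : ℕ => lambertTerm 1 τ x (n + 1) :=
    (summable_pnat_iff_summable_succ (f := lambertTerm 1 τ x)).mp h1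
  rw [lambertSum_eq_tsum_nat, lambertSum_eq_tsum_nat, lambertSum_eq_tsum_nat,
    ← hs1.tsum_sub hs0, (hs1.sub hs0).tsum_eq_zero_add]
  have : ∀ n : ℕ, lambertTerm 1 τ (x * nome τ) (n + 1) =
      lambertTerm 1 τ x (n + 1 + 1) - lambertTerm 0 τ x (n + 1 + 1) := by
    intro n
    simp only [lambertTerm, pow_zero, pow_one, one_mul, pow_succ' (nome τ) (n + 1), mul_assoc]
    push_cast
    ring
  simp only [this]
  simp [lambertTerm]

lemma ellNome_add_tau (z : ℂ) (τ : ℍ) : ellNome (z + τ) = ellNome z * nome τ := by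
  simp only [ellNome, nome, ← Complex.exp_add]
  ring_nf

lemma ellNome_add_int (z : ℂ) (u : ℤ) : ellNome (z + u) = ellNome z := by
  rw [ellNome, mul_add, Complex.exp_add, ellNome]
  have : cexp (2 * π * I * u) = 1 := by
    rw [mul_comm]
    exact Complex.exp_int_mul_two_pi_mul_I u
  rw [this, mul_one]

lemma deformedEisenstein_add_int (n : ℕ) (z : ℂ) (τ : ℍ) (u : ℤ) :
    deformedEisenstein n (z + u) τ = deformedEisenstein n z τ := by
  simp only [deformedEisenstein, ellNome_add_int]

/-- The term lost from the series in `p` cancels `pq/(pq-1)`; the one gained by the series in `p⁻¹`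
is `1/(p-1) = p/(p-1) - 1`, whence the jump `-1`. -/
lemma deformedEisenstein_one_add_tau {τ : ℍ} {z : ℂ} (hz : z ∈ offLattice τ) :
    deformedEisenstein 1 (z + τ) τ = deformedEisenstein 1 z τ - 1 := by
  have hz' : z + τ ∈ offLattice τ := by simpa using offLattice_add hz 1 0
  have hs := summable_lambertTerm (offLattice_neg hz') 0
  have h2 := lambertSum_zero_mul_nome hs
  have hp := ellNome_ne_zero z
  have hq := nome_ne_zero τ
  -- For the inverse variable the shift law is used at `(pq)⁻¹` and read backwards.
  have hx : (ellNome z * nome τ)⁻¹ * nome τ = (ellNome z)⁻¹ := by field_simp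
  rw [ellNome_neg, ellNome_add_tau, hx] at h2
  rw [deformedEisenstein_one hz, deformedEisenstein_one hz', ellNome_add_tau,
    lambertSum_zero_mul_nome (summable_lambertTerm hz 0), h2]
  have h3 : ellNome z - 1 ≠ 0 := sub_ne_zero.mpr (ellNome_ne_one hz)
  have h4 : ellNome z * nome τ - 1 ≠ 0 := by
    rw [← ellNome_add_tau]
    exact sub_ne_zero.mpr (ellNome_ne_one hz')
  have h5 : (ellNome z)⁻¹ / (1 - (ellNome z)⁻¹) = 1 / (ellNome z - 1) := by
    have h5 : 1 - (ellNome z)⁻¹ = (ellNome z - 1) / ellNome z := by field_simp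
    rw [h5]
    field_simp
  have h6 : ellNome z * nome τ / (1 - ellNome z * nome τ) =
      -(ellNome z * nome τ / (ellNome z * nome τ - 1)) := by
    rw [← neg_sub, div_neg]
  have h7 : ellNome z / (ellNome z - 1) = 1 + 1 / (ellNome z - 1) := by
    field_simp
    ring
  rw [h5, h6, h7]
  ring

lemma deformedEisenstein_two_add_tau {τ : ℍ} {z : ℂ} (hz : z ∈ offLattice τ) :
    deformedEisenstein 2 (z + τ) τ =
      deformedEisenstein 2 z τ - 2 * deformedEisenstein 1 z τ + 1 := by
  have hz' : z + τ ∈ offLattice τ := by simpa using offLattice_add hz 1 0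
  have h2 := lambertSum_zero_mul_nome (summable_lambertTerm (offLattice_neg hz') 0)
  have h2' := lambertSum_one_mul_nome (summable_lambertTerm (offLattice_neg hz') 0)
    (summable_lambertTerm (offLattice_neg hz') 1)
  have hp := ellNome_ne_zero z
  have hq := nome_ne_zero τ
  have hx : (ellNome z * nome τ)⁻¹ * nome τ = (ellNome z)⁻¹ := by field_simp
  rw [ellNome_neg, ellNome_add_tau, hx] at h2 h2'
  rw [deformedEisenstein_one hz, deformedEisenstein_two hz, deformedEisenstein_two hz',
    ellNome_add_tau,
    lambertSum_one_mul_nome (summable_lambertTerm hz 0) (summable_lambertTerm hz 1), h2, h2']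
  have h3 : ellNome z - 1 ≠ 0 := sub_ne_zero.mpr (ellNome_ne_one hz)
  have h5 : (ellNome z)⁻¹ / (1 - (ellNome z)⁻¹) = 1 / (ellNome z - 1) := by
    have h5 : 1 - (ellNome z)⁻¹ = (ellNome z - 1) / ellNome z := by field_simp
    rw [h5]
    field_simp
  have h7 : ellNome z / (ellNome z - 1) = 1 + 1 / (ellNome z - 1) := by
    field_simp
    ring
  rw [h5, h7]
  ring

lemma deformedEisenstein_one_add_lattice {τ : ℍ} {z : ℂ} (hz : z ∈ offLattice τ) (l u : ℤ) :
    deformedEisenstein 1 (z + l * τ + u) τ = deformedEisenstein 1 z τ - l := by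
  rw [deformedEisenstein_add_int]
  induction l using Int.induction_on with
  | zero => simp
  | succ n ih =>
    have h := deformedEisenstein_one_add_tau (offLattice_add hz n 0)
    simp only [Int.cast_zero, add_zero, Int.cast_natCast] at h ih
    push_cast
    rw [show z + (n + 1) * τ = z + n * τ + τ by ring, h, ih]
    ring
  | pred n ih =>
    have h := deformedEisenstein_one_add_tau (offLattice_add hz (-n - 1) 0)
    push_cast at h ih ⊢
    rw [add_zero, show z + (-n - 1) * τ + τ = z + -n * τ by ring, ih] at h
    linear_combination -h

lemma deformedEisenstein_two_add_lattice {τ : ℍ} {z : ℂ} (hz : z ∈ offLattice τ) (l u : ℤ) :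
    deformedEisenstein 2 (z + l * τ + u) τ =
      deformedEisenstein 2 z τ - 2 * l * deformedEisenstein 1 z τ + l ^ 2 := by
  rw [deformedEisenstein_add_int]
  induction l using Int.induction_on with
  | zero => simp
  | succ n ih =>
    have h := deformedEisenstein_two_add_tau (offLattice_add hz n 0)
    have h1 := deformedEisenstein_one_add_lattice hz n 0
    simp only [Int.cast_zero, add_zero, Int.cast_natCast] at h ih h1
    push_cast
    rw [show z + (n + 1) * τ = z + n * τ + τ by ring, h, ih, h1]
    ring
  | pred n ih =>
    have h := deformedEisenstein_two_add_tau (offLattice_add hz (-n - 1) 0)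
    have h1 := deformedEisenstein_one_add_lattice hz (-n - 1) 0
    push_cast at h ih h1 ⊢
    rw [h1, add_zero, show z + (-n - 1) * τ + τ = z + -n * τ by ring, ih] at h
    linear_combination -h

/-! ### Behaviour of `J₁`, `J₂` at the origin -/

lemma lambertSum_eq_double (N : ℕ) (τ : ℍ) {x : ℂ} (hx : ‖x‖ * ‖nome τ‖ < 1) :
    lambertSum N τ x = ∑' y : ℕ+ × ℕ+,
      ((y.2 : ℕ) : ℂ) ^ N * x ^ (y.1 : ℕ) * nome τ ^ ((y.1 : ℕ) * (y.2 : ℕ)) :=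
  (tsum_double N τ hx).symm

/-- The double series converges for `|x| < |q|⁻¹`, a disc with `1` in its interior; `ρ` is the
midpoint of `1` and `|q|⁻¹`, and the series at `ρ` is the majorant. -/
lemma continuousAt_lambertSum_one (N : ℕ) (τ : ℍ) : ContinuousAt (lambertSum N τ) 1 := by
  have h0 := norm_nome_pos τ
  have h1 := norm_nome_lt_one τ
  set ρ : ℝ := (1 + ‖nome τ‖⁻¹) / 2 with hρ
  have hinv : 1 < ‖nome τ‖⁻¹ := (one_lt_inv₀ h0).mpr h1
  have hρ1 : 1 < ρ := by rw [hρ]; linarith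
  have hρq : ρ * ‖nome τ‖ < 1 := by
    rw [hρ, div_mul_eq_mul_div, add_mul, inv_mul_cancel₀ h0.ne']
    linarith
  have hs := (summable_double N τ (x := (ρ : ℂ))
    (by rwa [Complex.norm_real, Real.norm_of_nonneg (by linarith)])).norm
  have hc : ContinuousOn (fun x : ℂ => ∑' y : ℕ+ × ℕ+,
      ((y.2 : ℕ) : ℂ) ^ N * x ^ (y.1 : ℕ) * nome τ ^ ((y.1 : ℕ) * (y.2 : ℕ)))
      (Metric.ball 0 ρ) := by
    refine continuousOn_tsum (fun y => by fun_prop) hs fun y x hx => ?_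
    rw [mem_ball_zero_iff] at hx
    simp only [norm_mul, norm_pow, Complex.norm_real, Real.norm_of_nonneg (by linarith : 0 ≤ ρ)]
    gcongr
  have hmem : Metric.ball (0 : ℂ) ρ ∈ nhds 1 :=
    Metric.isOpen_ball.mem_nhds (by simpa using hρ1)
  refine (hc.continuousAt hmem).congr ?_
  filter_upwards [hmem] with x hx
  rw [mem_ball_zero_iff] at hx
  refine (lambertSum_eq_double N τ ?_).symm
  exact (mul_le_mul_of_nonneg_right hx.le h0.le).trans_lt hρq

lemma ellNome_zero : ellNome 0 = 1 := by simp [ellNome]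

lemma E2_eq_lambertSum (τ : ℍ) : EisensteinSeries.E2 τ = 1 - 24 * lambertSum 1 τ 1 := by
  have hq := norm_nome_lt_one τ
  have h1 := tsum_double 1 τ (x := 1) (by simpa using hq)
  have h2 := tsum_prod_pow_eq_tsum_sigma 1 hq
  have h3 := summable_double 1 τ (x := 1) (by simpa using hq)
  rw [lambertSum_eq_double 1 τ (by simpa using hq), EisensteinSeries.E2_eq_tsum_cexp,
    h3.tsum_prod]
  congr 2
  simpa [nome] using h2.symm

lemma tendsto_lambertSum_ellNome (N : ℕ) (τ : ℍ) :
    Filter.Tendsto (fun z => lambertSum N τ (ellNome z)) (nhdsWithin 0 {0}ᶜ)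
      (nhds (lambertSum N τ 1)) := by
  have h := differentiable_ellNome.continuous.tendsto 0
  rw [ellNome_zero] at h
  exact ((continuousAt_lambertSum_one N τ).tendsto.comp h).mono_left nhdsWithin_le_nhds

lemma tendsto_lambertSum_ellNome_inv (N : ℕ) (τ : ℍ) :
    Filter.Tendsto (fun z => lambertSum N τ (ellNome z)⁻¹) (nhdsWithin 0 {0}ᶜ)
      (nhds (lambertSum N τ 1)) := by
  have h := (differentiable_ellNome.continuous.tendsto 0).inv₀ (ellNome_ne_zero 0)
  rw [ellNome_zero, inv_one] at h
  exact ((continuousAt_lambertSum_one N τ).tendsto.comp h).mono_left nhdsWithin_le_nhds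

lemma tendsto_deformedEisenstein_two (τ : ℍ) :
    Filter.Tendsto (fun z => deformedEisenstein 2 z τ) (nhdsWithin 0 {0}ᶜ)
      (nhds (EisensteinSeries.E2 τ / 6)) := by
  have h := (((tendsto_lambertSum_ellNome 1 τ).add
    (tendsto_lambertSum_ellNome_inv 1 τ)).const_mul 2).const_sub (1 / 6)
  have e : EisensteinSeries.E2 τ / 6 = 1 / 6 - 2 * (lambertSum 1 τ 1 + lambertSum 1 τ 1) := by
    rw [E2_eq_lambertSum]
    ring
  rw [e]
  refine h.congr' ?_
  filter_upwards [eventually_offLattice τ] with z hz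
  rw [deformedEisenstein_two hz]

/-- Only `p/(p-1)` is singular at `0`, with a simple pole governed by the derivative `2πi` of `p`.
-/
lemma tendsto_mul_deformedEisenstein_one (τ : ℍ) :
    Filter.Tendsto (fun z => z * deformedEisenstein 1 z τ) (nhdsWithin 0 {0}ᶜ)
      (nhds (2 * π * I)⁻¹) := by
  have hid : Filter.Tendsto (fun z : ℂ => z) (nhdsWithin 0 {0}ᶜ) (nhds 0) :=
    Filter.tendsto_id.mono_left nhdsWithin_le_nhds
  have h1 := (((tendsto_lambertSum_ellNome 0 τ).sub
    (tendsto_lambertSum_ellNome_inv 0 τ)).const_add (1 / 2))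
  have h2 := hid.mul h1
  have hd : HasDerivAt ellNome (2 * π * I) 0 := by
    have := ((hasDerivAt_id (0 : ℂ)).const_mul (2 * π * I)).cexp
    simpa using! this
  have h3 := (hasDerivAt_iff_tendsto_slope.mp hd).inv₀ Complex.two_pi_I_ne_zero
  have hp := (differentiable_ellNome.continuous.tendsto 0).mono_left
    (nhdsWithin_le_nhds (s := {0}ᶜ))
  have h4 := (h3.mul hp).sub h2
  rw [ellNome_zero, zero_mul, mul_one, sub_zero] at h4
  refine h4.congr' ?_
  filter_upwards [eventually_offLattice τ, self_mem_nhdsWithin] with z hz hz0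
  rw [deformedEisenstein_one hz, slope_def_field, ellNome_zero]
  have h5 : ellNome z - 1 ≠ 0 := sub_ne_zero.mpr (ellNome_ne_one hz)
  rw [sub_zero, inv_div]
  field_simp
  ring

/-! ### Modular transformation of `J₁`, `J₂` -/

section modular

variable (γ : SL(2, ℤ)) (τ : ℍ)

lemma denom_SL : denom γ τ = (γ 1 0 : ℂ) * τ + γ 1 1 := by
  exact ModularGroup.denom_apply γ τ

lemma coe_smul_SL : ((γ • τ : ℍ) : ℂ) = ((γ 0 0 : ℂ) * τ + γ 0 1) / denom γ τ := by
  rw [coe_specialLinearGroup_apply, denom_SL]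
  simp

lemma det_SL : (γ 0 0 : ℂ) * γ 1 1 - γ 0 1 * γ 1 0 = 1 := by
  have := γ.det_coe
  rw [Matrix.det_fin_two] at this
  exact_mod_cast this

lemma denom_SL_ne_zero : denom γ τ ≠ 0 := denom_ne_zero γ τ

/-- Dividing `ℤτ + ℤ` by `cτ + d` gives the lattice of `γτ`. This identity and the next turn the
periods `1`, `τ` of `z` into lattice translations of `z/(cτ+d)`. -/
lemma inv_denom_eq : (1 : ℂ) / denom γ τ = -(γ 1 0 : ℂ) * (γ • τ : ℍ) + γ 0 0 := by
  have h := denom_SL_ne_zero γ τ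
  rw [coe_smul_SL]
  field_simp
  rw [denom_SL]
  linear_combination -det_SL γ

lemma tau_div_denom_eq : (τ : ℂ) / denom γ τ = (γ 1 1 : ℂ) * (γ • τ : ℍ) - γ 0 1 := by
  have h := denom_SL_ne_zero γ τ
  rw [coe_smul_SL]
  field_simp
  rw [denom_SL]
  linear_combination -(τ : ℂ) * det_SL γ

variable {γ τ}

lemma div_denom_mem_offLattice {z : ℂ} (hz : z ∈ offLattice τ) :
    z / denom γ τ ∈ offLattice (γ • τ) := by
  intro l u h
  have hj := denom_SL_ne_zero γ τ
  refine hz (l * γ 0 0 + u * γ 1 0) (l * γ 0 1 + u * γ 1 1) ?_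
  rw [div_eq_iff hj, coe_smul_SL, add_mul, ← mul_div_assoc, div_mul_cancel₀ _ hj, denom_SL] at h
  rw [h]
  push_cast
  ring

lemma E2_smul : EisensteinSeries.E2 (γ • τ) =
    denom γ τ ^ 2 * EisensteinSeries.E2 τ + 12 * γ 1 0 * denom γ τ / (2 * π * I) := by
  have h := congrFun (EisensteinSeries.E2_slash_action γ) τ
  have hj := denom_SL_ne_zero γ τ
  rw [ModularForm.SL_slash_apply] at h
  simp only [Pi.sub_apply, Pi.smul_apply, EisensteinSeries.D2, riemannZeta_two, smul_eq_mul] at h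
  rw [zpow_neg, ← div_eq_mul_inv, div_eq_iff (zpow_ne_zero _ hj)] at h
  rw [h]
  have hpi : (π : ℂ) ≠ 0 := by exact_mod_cast Real.pi_ne_zero
  have hI := I_ne_zero
  have hz2 : denom γ τ ^ (2 : ℤ) = denom γ τ ^ 2 := zpow_ofNat _ 2
  rw [hz2]
  field_simp
  ring_nf
  simp only [I_sq]
  ring

/-- The jumps of `J₁` under both periods match, and the principal parts at `0` agree, so the
difference of the two sides is constant; it is odd, hence zero. -/
theorem deformedEisenstein_one_modular {z : ℂ} (hz : z ∈ offLattice τ) :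
    deformedEisenstein 1 (z / denom γ τ) (γ • τ) =
      denom γ τ * deformedEisenstein 1 z τ + γ 1 0 * z := by
  have hj := denom_SL_ne_zero γ τ
  set j := denom γ τ with hjdef
  set f : ℂ → ℂ := fun z => deformedEisenstein 1 (z / j) (γ • τ) -
    (j * deformedEisenstein 1 z τ + γ 1 0 * z) with hf
  have hd : ∀ z ∈ offLattice τ, DifferentiableAt ℂ f z := by
    intro z hz
    have h1 := differentiableAt_deformedEisenstein 1 (γ • τ) (div_denom_mem_offLattice (γ := γ) hz)
    have h2 := differentiableAt_deformedEisenstein 1 τ hz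
    exact (DifferentiableAt.comp z h1 (differentiableAt_id.div_const j)).sub
      ((h2.const_mul j).add (differentiableAt_id.const_mul _))
  have hp1 : ∀ z ∈ offLattice τ, f (z + 1) = f z := by
    intro z hz
    have h1 := deformedEisenstein_one_add_lattice (div_denom_mem_offLattice (γ := γ) hz)
      (-γ 1 0) (γ 0 0)
    have h2 := deformedEisenstein_add_int 1 z τ 1
    push_cast at h1 h2
    rw [add_assoc, ← inv_denom_eq, ← add_div] at h1
    simp only [hf, h2, hjdef, h1]
    ring
  have hpτ : ∀ z ∈ offLattice τ, f (z + τ) = f z := by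
    intro z hz
    have h1 := deformedEisenstein_one_add_lattice (div_denom_mem_offLattice (γ := γ) hz)
      (γ 1 1) (-γ 0 1)
    have h2 := deformedEisenstein_one_add_tau hz
    push_cast at h1
    rw [add_assoc, ← sub_eq_add_neg, ← tau_div_denom_eq, ← add_div] at h1
    simp only [hf, h2, hjdef, h1]
    linear_combination denom_SL γ τ
  have h0 : Filter.Tendsto (fun z => z * f z) (nhdsWithin 0 {0}ᶜ) (nhds 0) := by
    have hid : Filter.Tendsto (fun z : ℂ => z) (nhdsWithin 0 {0}ᶜ) (nhds 0) :=
      Filter.tendsto_id.mono_left nhdsWithin_le_nhds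
    have hdiv : Filter.Tendsto (fun z : ℂ => z / j) (nhdsWithin 0 {0}ᶜ) (nhdsWithin 0 {0}ᶜ) := by
      refine tendsto_nhdsWithin_iff.mpr ⟨?_, ?_⟩
      · simpa using hid.div_const j
      · filter_upwards [self_mem_nhdsWithin] with z hz0
        exact div_ne_zero hz0 hj
    -- The poles cancel because `z J₁(z/j) = j · (z/j) J₁(z/j)` has the same limit as `j · z J₁(z)`.
    have h1 := ((tendsto_mul_deformedEisenstein_one (γ • τ)).comp hdiv).const_mul j
    have h2 := (tendsto_mul_deformedEisenstein_one τ).const_mul j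
    have h3 := (h1.sub h2).sub ((hid.mul hid).const_mul (γ 1 0 : ℂ))
    simp only [sub_self, mul_zero] at h3
    refine h3.congr fun z => ?_
    simp only [hf, Function.comp]
    field_simp
    ring
  obtain ⟨L, hL⟩ := eq_const_of_doublyPeriodic hd hp1 hpτ h0
  have h1 := hL z hz
  have h2 := hL (-z) (offLattice_neg hz)
  simp only [hf] at h1 h2
  rw [neg_div, deformedEisenstein_one_neg hz,
    deformedEisenstein_one_neg (div_denom_mem_offLattice hz)] at h2
  linear_combination (h1 - h2) / 2

/-- Again the difference is doubly periodic. `J₂` has a finite limit at `0`, and there the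
difference tends to `0`, which determines the constant. -/
theorem deformedEisenstein_two_modular {z : ℂ} (hz : z ∈ offLattice τ) :
    deformedEisenstein 2 (z / denom γ τ) (γ • τ) =
      denom γ τ ^ 2 * deformedEisenstein 2 z τ +
        2 * γ 1 0 * z * denom γ τ * deformedEisenstein 1 z τ + (γ 1 0) ^ 2 * z ^ 2 := by
  have hj := denom_SL_ne_zero γ τ
  set j := denom γ τ with hjdef
  set f : ℂ → ℂ := fun z => deformedEisenstein 2 (z / j) (γ • τ) -
    (j ^ 2 * deformedEisenstein 2 z τ +
      2 * γ 1 0 * z * j * deformedEisenstein 1 z τ + (γ 1 0) ^ 2 * z ^ 2) with hf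
  have hd : ∀ z ∈ offLattice τ, DifferentiableAt ℂ f z := by
    intro z hz
    have h1 := differentiableAt_deformedEisenstein 2 (γ • τ) (div_denom_mem_offLattice (γ := γ) hz)
    have h2 := differentiableAt_deformedEisenstein 1 τ hz
    have h3 := differentiableAt_deformedEisenstein 2 τ hz
    exact (DifferentiableAt.comp z h1 (differentiableAt_id.div_const j)).sub
      (((h3.const_mul _).add (((differentiableAt_id.const_mul _).mul_const _).mul h2)).add
        ((differentiableAt_id.pow 2).const_mul _))
  have hp1 : ∀ z ∈ offLattice τ, f (z + 1) = f z := by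
    intro z hz
    have h1 := deformedEisenstein_two_add_lattice (div_denom_mem_offLattice (γ := γ) hz)
      (-γ 1 0) (γ 0 0)
    have h2 := deformedEisenstein_add_int 1 z τ 1
    have h3 := deformedEisenstein_add_int 2 z τ 1
    have h4 := deformedEisenstein_one_modular (γ := γ) hz
    push_cast at h1 h2 h3
    rw [add_assoc, ← inv_denom_eq, ← add_div, h4] at h1
    simp only [hf, h2, h3, hjdef, h1]
    ring
  have hpτ : ∀ z ∈ offLattice τ, f (z + τ) = f z := by
    intro z hz
    have h1 := deformedEisenstein_two_add_lattice (div_denom_mem_offLattice (γ := γ) hz)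
      (γ 1 1) (-γ 0 1)
    have h2 := deformedEisenstein_one_add_tau hz
    have h3 := deformedEisenstein_two_add_tau hz
    have h4 := deformedEisenstein_one_modular (γ := γ) hz
    push_cast at h1
    rw [add_assoc, ← sub_eq_add_neg, ← tau_div_denom_eq, ← add_div, h4] at h1
    simp only [hf, h2, h3, hjdef, h1]
    simp only [denom_SL]
    ring
  have hlim : Filter.Tendsto f (nhdsWithin 0 {0}ᶜ) (nhds 0) := by
    have hid : Filter.Tendsto (fun z : ℂ => z) (nhdsWithin 0 {0}ᶜ) (nhds 0) :=
      Filter.tendsto_id.mono_left nhdsWithin_le_nhds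
    have hdiv : Filter.Tendsto (fun z : ℂ => z / j) (nhdsWithin 0 {0}ᶜ) (nhdsWithin 0 {0}ᶜ) := by
      refine tendsto_nhdsWithin_iff.mpr ⟨?_, ?_⟩
      · simpa using hid.div_const j
      · filter_upwards [self_mem_nhdsWithin] with z hz0
        exact div_ne_zero hz0 hj
    have h1 := (tendsto_deformedEisenstein_two (γ • τ)).comp hdiv
    have h2 := (tendsto_deformedEisenstein_two τ).const_mul (j ^ 2)
    have h3 := (tendsto_mul_deformedEisenstein_one τ).const_mul (2 * γ 1 0 * j)
    have h4 := (hid.pow 2).const_mul ((γ 1 0 : ℂ) ^ 2)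
    have h5 := h1.sub ((h2.add h3).add h4)
    -- The quasimodular term `2cj/(2πi)` of `E₂/6` is exactly the limit of `2czj J₁`.
    have e : EisensteinSeries.E2 (γ • τ) / 6 - (j ^ 2 * (EisensteinSeries.E2 τ / 6) +
        2 * γ 1 0 * j * (2 * π * I)⁻¹ + (γ 1 0 : ℂ) ^ 2 * 0 ^ 2) = 0 := by
      rw [E2_smul]
      ring
    rw [e] at h5
    refine h5.congr fun z => ?_
    simp only [hf, Function.comp]
    ring
  have h0 : Filter.Tendsto (fun z => z * f z) (nhdsWithin 0 {0}ᶜ) (nhds 0) := by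
    have hid : Filter.Tendsto (fun z : ℂ => z) (nhdsWithin 0 {0}ᶜ) (nhds 0) :=
      Filter.tendsto_id.mono_left nhdsWithin_le_nhds
    simpa using hid.mul hlim
  obtain ⟨L, hL⟩ := eq_const_of_doublyPeriodic hd hp1 hpτ h0
  have hL0 : L = 0 := by
    refine tendsto_nhds_unique (tendsto_const_nhds.congr' ?_) hlim
    filter_upwards [eventually_offLattice τ] with w hw
    exact (hL w hw).symm
  have h1 := hL z hz
  rw [hL0] at h1
  exact sub_eq_zero.mp h1

end modular

/-! ### Transformation of the derivatives of a Jacobi form -/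

/-- The coefficients of `F' = (2πi)⁻¹ ∂F/∂τ`. -/
def coeffTau (c : ℤ × ℤ → ℂ) : ℤ × ℤ → ℂ := fun x => x.1 * c x

/-- The coefficients of `F^• = (2πi)⁻¹ ∂F/∂z`. -/
def coeffZ (c : ℤ × ℤ → ℂ) : ℤ × ℤ → ℂ := fun x => x.2 * c x

lemma IsConeSeries.coeffTau (h : IsConeSeries m c) : IsConeSeries m (coeffTau c) := h.fst_mul

lemma IsConeSeries.coeffZ (h : IsConeSeries m c) : IsConeSeries m (coeffZ c) := h.snd_mul

/-- Differentiating a transformation law in `τ` also moves the elliptic argument, hence the chain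
rule along a curve in both variables. -/
lemma IsConeSeries.hasDerivAt_curve (h : IsConeSeries m c) {z t : ℂ → ℂ} {z' t' s : ℂ}
    (hz : HasDerivAt z z' s) (ht : HasDerivAt t t' s) (him : 0 < (t s).im) :
    HasDerivAt (fun s => laurentSum c (z s) (t s))
      (2 * π * I * (laurentSum (JacobiSerre.coeffTau c) (z s) (t s) * t' +
        laurentSum (JacobiSerre.coeffZ c) (z s) (t s) * z')) s := by
  have h1 := (h.hasFDerivAt (z s, t s) him).comp_hasDerivAt s (hz.prodMk ht)
  refine h1.congr_deriv ?_
  simp only [_root_.add_apply, _root_.smul_apply,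
    ContinuousLinearMap.coe_fst', ContinuousLinearMap.coe_snd', smul_eq_mul]
  unfold JacobiSerre.coeffTau JacobiSerre.coeffZ
  ring

lemma IsConeSeries.hasDerivAt_z (h : IsConeSeries m c) {f : ℂ → ℂ} {f' z : ℂ}
    (hf : HasDerivAt f f' z) (τ : ℍ) :
    HasDerivAt (fun w => laurentSum c (f w) τ)
      (2 * π * I * (laurentSum (JacobiSerre.coeffZ c) (f z) τ * f')) z := by
  refine (h.hasDerivAt_curve hf (hasDerivAt_const z (τ : ℂ)) τ.im_pos).congr_deriv ?_
  ring

/-! ### Elliptic transformation of `F^•`, `F^••` and `F'` -/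

section elliptic

/-- The automorphy factor `exp(-2πim(l²t + 2lz))`. -/
def ellFactor (m : ℕ) (l : ℤ) (z t : ℂ) : ℂ :=
  cexp (-(2 * π * I * m * ((l : ℂ) ^ 2 * t + 2 * l * z)))

lemma hasDerivAt_ellFactor_z (m : ℕ) (l : ℤ) (z t : ℂ) :
    HasDerivAt (fun w => ellFactor m l w t)
      (2 * π * I * (-(2 * m * l) * ellFactor m l z t)) z := by
  have h := (((((hasDerivAt_id z).const_mul (2 * (l : ℂ))).const_add ((l : ℂ) ^ 2 * t)).const_mul
    (2 * π * I * m)).neg).cexp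
  refine h.congr_deriv ?_
  simp only [ellFactor, Pi.neg_apply, id]
  ring

lemma hasDerivAt_ellFactor_t (m : ℕ) (l : ℤ) (z t : ℂ) :
    HasDerivAt (fun w => ellFactor m l z w)
      (2 * π * I * (-(m * l ^ 2) * ellFactor m l z t)) t := by
  have h := (((((hasDerivAt_id t).const_mul ((l : ℂ) ^ 2)).add_const (2 * (l : ℂ) * z)).const_mul
    (2 * π * I * m)).neg).cexp
  refine h.congr_deriv ?_
  simp only [ellFactor, Pi.neg_apply, id]
  ring

variable (h : IsConeSeries m c)
  (hE : ∀ (l u : ℤ) (z : ℂ) (τ : ℍ),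
    laurentSum c (z + l * τ + u) τ = ellFactor m l z τ * laurentSum c z τ)
  (l u : ℤ) (z : ℂ) (τ : ℍ)

include h hE

lemma elliptic_coeffZ : laurentSum (coeffZ c) (z + l * τ + u) τ =
    ellFactor m l z τ * (laurentSum (coeffZ c) z τ - 2 * m * l * laurentSum c z τ) := by
  have h1 := h.hasDerivAt_z (((hasDerivAt_id z).add_const (l * τ : ℂ)).add_const (u : ℂ)) τ
  have h2 := (hasDerivAt_ellFactor_z m l z τ).mul (h.hasDerivAt_z (hasDerivAt_id z) τ)
  have e : (fun w => laurentSum c (w + l * τ + u) τ) =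
      fun w => ellFactor m l w τ * laurentSum c w τ := funext fun w => hE l u w τ
  have h3 := h1.unique (h2.congr_of_eventuallyEq (.of_forall fun y => congrFun e y))
  refine mul_left_cancel₀ Complex.two_pi_I_ne_zero ?_
  simp only [id, mul_one] at h3
  linear_combination h3

lemma elliptic_coeffZ_coeffZ : laurentSum (coeffZ (coeffZ c)) (z + l * τ + u) τ =
    ellFactor m l z τ * (laurentSum (coeffZ (coeffZ c)) z τ -
      4 * m * l * laurentSum (coeffZ c) z τ + 4 * m ^ 2 * l ^ 2 * laurentSum c z τ) := by
  have h1 := h.coeffZ.hasDerivAt_z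
    (((hasDerivAt_id z).add_const (l * τ : ℂ)).add_const (u : ℂ)) τ
  have h2 := (hasDerivAt_ellFactor_z m l z τ).mul
    ((h.coeffZ.hasDerivAt_z (hasDerivAt_id z) τ).sub
      ((h.hasDerivAt_z (hasDerivAt_id z) τ).const_mul (2 * (m : ℂ) * l)))
  have e : (fun w => laurentSum (coeffZ c) (w + l * τ + u) τ) =
      fun w => ellFactor m l w τ * (laurentSum (coeffZ c) w τ - 2 * m * l * laurentSum c w τ) :=
    funext fun w => elliptic_coeffZ h hE l u w τ
  have h3 := h1.unique (h2.congr_of_eventuallyEq (.of_forall fun y => congrFun e y))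
  refine mul_left_cancel₀ Complex.two_pi_I_ne_zero ?_
  simp only [id, mul_one, Pi.sub_apply] at h3
  linear_combination h3

lemma elliptic_coeffTau : laurentSum (coeffTau c) (z + l * τ + u) τ =
    ellFactor m l z τ * (laurentSum (coeffTau c) z τ - l * laurentSum (coeffZ c) z τ +
      m * l ^ 2 * laurentSum c z τ) := by
  have h1 := h.hasDerivAt_curve
    ((((hasDerivAt_id (τ : ℂ)).const_mul (l : ℂ)).const_add z).add_const (u : ℂ))
    (hasDerivAt_id (τ : ℂ)) τ.im_pos
  have h2 := (hasDerivAt_ellFactor_t m l z τ).mul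
    (h.hasDerivAt_curve (hasDerivAt_const (τ : ℂ) z) (hasDerivAt_id (τ : ℂ)) τ.im_pos)
  have e : (fun w => laurentSum c (z + l * w + u) w) =ᶠ[nhds (τ : ℂ)]
      fun w => ellFactor m l z w * laurentSum c z w := by
    filter_upwards [isOpen_upperHalfPlaneSet.mem_nhds τ.im_pos] with w hw
    exact hE l u z ⟨w, hw⟩
  have h3 := h1.unique (h2.congr_of_eventuallyEq e)
  -- The argument `z + lτ + u` has `τ`-derivative `l`, which brings in `F^•` at the translated
  -- point.
  have h4 := elliptic_coeffZ h hE l u z τ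
  refine mul_left_cancel₀ Complex.two_pi_I_ne_zero ?_
  simp only [id, mul_one, mul_zero, add_zero] at h3
  linear_combination h3 - 2 * π * I * l * h4

end elliptic

/-! ### Modular transformation of `F^•`, `F^••` and `F'` -/

section modular

/-- The automorphy factor `exp(2πi m c z² / j)`. -/
def modFactor (m : ℕ) (c j z : ℂ) : ℂ := cexp (2 * π * I * m * c * z ^ 2 / j)

lemma hasDerivAt_modFactor_z (m : ℕ) (c j z : ℂ) :
    HasDerivAt (fun w => modFactor m c j w)
      (2 * π * I * (2 * m * c * z / j * modFactor m c j z)) z := by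
  have h := ((((hasDerivAt_id z).pow 2).const_mul (2 * π * I * m * c)).div_const j).cexp
  refine h.congr_deriv ?_
  simp only [modFactor, Pi.pow_apply, id]
  push_cast
  ring

lemma hasDerivAt_modFactor_t (m : ℕ) (c d z t : ℂ) (hj : c * t + d ≠ 0) :
    HasDerivAt (fun t => modFactor m c (c * t + d) z)
      (2 * π * I * (-(m * c ^ 2 * z ^ 2 / (c * t + d) ^ 2) * modFactor m c (c * t + d) z)) t := by
  have h := ((hasDerivAt_const t (2 * π * I * m * c * z ^ 2)).div
    (((hasDerivAt_id t).const_mul c).add_const d) hj).cexp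
  refine h.congr_deriv ?_
  simp only [modFactor, Pi.div_apply, id]
  ring

variable {w : ℤ} (h : IsConeSeries m c)
  (hM : ∀ (γ : SL(2, ℤ)) (z : ℂ) (τ : ℍ), laurentSum c (z / denom γ τ) (γ • τ : ℍ) =
    denom γ τ ^ w * modFactor m (γ 1 0) (denom γ τ) z * laurentSum c z τ)
  (γ : SL(2, ℤ)) (z : ℂ) (τ : ℍ)

include h hM

lemma modular_coeffZ : laurentSum (coeffZ c) (z / denom γ τ) (γ • τ : ℍ) =
    denom γ τ ^ w * modFactor m (γ 1 0) (denom γ τ) z *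
      (denom γ τ * laurentSum (coeffZ c) z τ + 2 * m * γ 1 0 * z * laurentSum c z τ) := by
  have hj := denom_SL_ne_zero γ τ
  have h1 := h.hasDerivAt_z ((hasDerivAt_id z).div_const (denom γ τ)) (γ • τ)
  have h2 := ((hasDerivAt_modFactor_z m (γ 1 0) (denom γ τ) z).const_mul (denom γ τ ^ w)).mul
    (h.hasDerivAt_z (hasDerivAt_id z) τ)
  have e : (fun y => laurentSum c (y / denom γ τ) (γ • τ : ℍ)) = fun y =>
      denom γ τ ^ w * modFactor m (γ 1 0) (denom γ τ) y * laurentSum c y τ :=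
    funext fun y => hM γ y τ
  have h3 := h1.unique (h2.congr_of_eventuallyEq (.of_forall fun y => congrFun e y))
  refine mul_left_cancel₀ (div_ne_zero Complex.two_pi_I_ne_zero hj) ?_
  simp only [id, mul_one] at h3
  field_simp at h3 ⊢
  linear_combination h3

/-- The term `2mcj/(2πi)` arises when the explicit factor `z` in the law of `F^•` is differentiated;
later `-(m/6)E₂F` cancels it. -/
lemma modular_coeffZ_coeffZ : laurentSum (coeffZ (coeffZ c)) (z / denom γ τ) (γ • τ : ℍ) =
    denom γ τ ^ w * modFactor m (γ 1 0) (denom γ τ) z *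
      (denom γ τ ^ 2 * laurentSum (coeffZ (coeffZ c)) z τ +
        4 * m * γ 1 0 * z * denom γ τ * laurentSum (coeffZ c) z τ +
        (4 * m ^ 2 * γ 1 0 ^ 2 * z ^ 2 + 2 * m * γ 1 0 * denom γ τ / (2 * π * I)) *
          laurentSum c z τ) := by
  have hj := denom_SL_ne_zero γ τ
  have h1 := h.coeffZ.hasDerivAt_z ((hasDerivAt_id z).div_const (denom γ τ)) (γ • τ)
  have h2 := ((hasDerivAt_modFactor_z m (γ 1 0) (denom γ τ) z).const_mul (denom γ τ ^ w)).mul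
    (((h.coeffZ.hasDerivAt_z (hasDerivAt_id z) τ).const_mul (denom γ τ)).add
      (((hasDerivAt_id z).const_mul (2 * (m : ℂ) * γ 1 0)).mul (h.hasDerivAt_z (hasDerivAt_id z) τ)))
  have e : (fun y => laurentSum (coeffZ c) (y / denom γ τ) (γ • τ : ℍ)) = fun y =>
      denom γ τ ^ w * modFactor m (γ 1 0) (denom γ τ) y *
      (denom γ τ * laurentSum (coeffZ c) y τ + 2 * m * γ 1 0 * y * laurentSum c y τ) :=
    funext fun y => modular_coeffZ h hM γ y τ
  have h3 := h1.unique (h2.congr_of_eventuallyEq (.of_forall fun y => congrFun e y))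
  have hpi := Complex.two_pi_I_ne_zero
  refine mul_left_cancel₀ (div_ne_zero hpi hj) ?_
  simp only [id, mul_one, Pi.add_apply, Pi.mul_apply] at h3
  have hpi' : (π : ℂ) ≠ 0 := by exact_mod_cast Real.pi_ne_zero
  have hI := I_ne_zero
  generalize denom γ τ ^ w = P at *
  generalize modFactor m (γ 1 0) (denom γ τ) z = M at *
  generalize denom γ τ = j at *
  field_simp at h3 ⊢
  linear_combination h3

lemma modular_coeffTau : laurentSum (coeffTau c) (z / denom γ τ) (γ • τ : ℍ) =
    denom γ τ ^ w * modFactor m (γ 1 0) (denom γ τ) z *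
      (denom γ τ ^ 2 * laurentSum (coeffTau c) z τ +
        γ 1 0 * z * denom γ τ * laurentSum (coeffZ c) z τ +
        (m * γ 1 0 ^ 2 * z ^ 2 + w * γ 1 0 * denom γ τ / (2 * π * I)) * laurentSum c z τ) := by
  have hj := denom_SL_ne_zero γ τ
  have hden := denom_SL γ τ
  have hj' : (γ 1 0 : ℂ) * τ + γ 1 1 ≠ 0 := hden ▸ hj
  have hτ' := coe_smul_SL γ τ
  have hd1 : HasDerivAt (fun t : ℂ => (γ 1 0 : ℂ) * t + γ 1 1) (γ 1 0 : ℂ) τ := by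
    simpa using ((hasDerivAt_id (τ : ℂ)).const_mul (γ 1 0 : ℂ)).add_const (γ 1 1 : ℂ)
  have hd2 : HasDerivAt (fun t : ℂ => (γ 0 0 : ℂ) * t + γ 0 1) (γ 0 0 : ℂ) τ := by
    simpa using ((hasDerivAt_id (τ : ℂ)).const_mul (γ 0 0 : ℂ)).add_const (γ 0 1 : ℂ)
  have h1 := h.hasDerivAt_curve ((hasDerivAt_const (τ : ℂ) z).div hd1 hj') (hd2.div hd1 hj')
    (by
      have := (γ • τ).im_pos
      rw [← UpperHalfPlane.coe_im, hτ', hden] at this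
      exact this)
  have h2 := ((((hasDerivAt_zpow w _ (Or.inl hj')).comp (τ : ℂ) hd1)).mul
    (hasDerivAt_modFactor_t m (γ 1 0) (γ 1 1) z τ hj')).mul
    (h.hasDerivAt_curve (hasDerivAt_const (τ : ℂ) z) (hasDerivAt_id (τ : ℂ)) τ.im_pos)
  have e : (fun t => laurentSum c (z / ((γ 1 0 : ℂ) * t + γ 1 1))
      (((γ 0 0 : ℂ) * t + γ 0 1) / ((γ 1 0 : ℂ) * t + γ 1 1))) =ᶠ[nhds (τ : ℂ)]
      fun t => ((γ 1 0 : ℂ) * t + γ 1 1) ^ w *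
        modFactor m (γ 1 0) ((γ 1 0 : ℂ) * t + γ 1 1) z * laurentSum c z t := by
    filter_upwards [isOpen_upperHalfPlaneSet.mem_nhds τ.im_pos] with t ht
    have := hM γ z ⟨t, ht⟩
    rwa [coe_smul_SL, denom_SL] at this
  have h3 := h1.unique (h2.congr_of_eventuallyEq e)
  have h4 := modular_coeffZ h hM γ z τ
  have hdet := det_SL γ
  -- The determinant condition makes the derivative of `γτ` equal to `1/(cτ+d)²`.
  have hnum : (γ 0 0 : ℂ) * (γ 1 0 * τ + γ 1 1) - (γ 0 0 * τ + γ 0 1) * γ 1 0 = 1 := by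
    linear_combination hdet
  simp only [Pi.mul_apply, Pi.div_apply, Function.comp, id, ← hden, ← hτ', zero_mul, zero_sub,
    mul_zero, add_zero, mul_one] at h3
  rw [← hden] at hnum
  rw [hnum, h4, zpow_sub_one₀ hj] at h3
  have hpi' : (π : ℂ) ≠ 0 := by exact_mod_cast Real.pi_ne_zero
  have hI := I_ne_zero
  refine mul_left_cancel₀ (div_ne_zero Complex.two_pi_I_ne_zero (pow_ne_zero 2 hj)) ?_
  clear hM h4 h1 h2 e hd1 hd2 hnum hτ' hden hj'
  generalize denom γ τ ^ w = P at *
  generalize modFactor m (γ 1 0) (denom γ τ) z = M at *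
  generalize laurentSum (coeffTau c) (z / denom γ τ) (γ • τ : ℍ) = X at *
  generalize denom γ τ = j at *
  field_simp at h3 ⊢
  linear_combination h3

end modular

/-! ### The differential operator on series -/

/-- The function `∂^J F` off the lattice, for `F` with Laurent coefficients `c`. -/
def serreSeries (w : ℂ) (m : ℕ) (c : ℤ × ℤ → ℂ) (z : ℂ) (τ : ℍ) : ℂ :=
  laurentSum (coeffTau c) z τ - w / 12 * EisensteinSeries.E2 τ * laurentSum c z τ +
    1 / (1 - 4 * (m : ℂ)) * (laurentSum (coeffZ (coeffZ c)) z τ -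
      deformedEisenstein 1 z τ * laurentSum (coeffZ c) z τ +
      m * deformedEisenstein 2 z τ * laurentSum c z τ -
      (m : ℂ) / 6 * EisensteinSeries.E2 τ * laurentSum c z τ)

lemma one_sub_four_mul_ne_zero (m : ℕ) : (1 : ℂ) - 4 * m ≠ 0 := by
  intro h
  have h1 : ((4 * m : ℕ) : ℂ) = (1 : ℕ) := by
    push_cast
    linear_combination -h
  have := Nat.cast_injective h1
  omega

/-- Up to the automorphy factor, the bracket picks up `(1-4m)(lF^• - ml²F)` and `F'` picks up
`-(lF^• - ml²F)`; the terms in `J₁F` cancel within the bracket. -/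
lemma serreSeries_elliptic (w : ℂ) (h : IsConeSeries m c)
    (hE : ∀ (l u : ℤ) (z : ℂ) (τ : ℍ),
      laurentSum c (z + l * τ + u) τ = ellFactor m l z τ * laurentSum c z τ)
    (l u : ℤ) {z : ℂ} {τ : ℍ} (hz : z ∈ offLattice τ) :
    serreSeries w m c (z + l * τ + u) τ = ellFactor m l z τ * serreSeries w m c z τ := by
  have hm := one_sub_four_mul_ne_zero m
  rw [serreSeries, serreSeries, elliptic_coeffTau h hE, elliptic_coeffZ_coeffZ h hE,
    elliptic_coeffZ h hE, hE, deformedEisenstein_one_add_lattice hz,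
    deformedEisenstein_two_add_lattice hz]
  have hK := one_div_mul_cancel hm
  generalize 1 / (1 - 4 * (m : ℂ)) = K at *
  linear_combination ellFactor m l z τ *
    (l * laurentSum (coeffZ c) z τ - m * l ^ 2 * laurentSum c z τ) * hK

/-- The `1/(2πi)` anomalies cancel against the two `E₂` terms. What is left is `czjF^• + mc²z²F`
from `F'` and `-(1-4m)` times it from the bracket. -/
lemma serreSeries_modular {w : ℤ} (h : IsConeSeries m c)
    (hM : ∀ (γ : SL(2, ℤ)) (z : ℂ) (τ : ℍ), laurentSum c (z / denom γ τ) (γ • τ : ℍ) =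
      denom γ τ ^ w * modFactor m (γ 1 0) (denom γ τ) z * laurentSum c z τ)
    (γ : SL(2, ℤ)) {z : ℂ} {τ : ℍ} (hz : z ∈ offLattice τ) :
    serreSeries w m c (z / denom γ τ) (γ • τ) =
      denom γ τ ^ (w + 2) * modFactor m (γ 1 0) (denom γ τ) z * serreSeries w m c z τ := by
  have hm := one_sub_four_mul_ne_zero m
  have hj := denom_SL_ne_zero γ τ
  rw [serreSeries, serreSeries, modular_coeffTau h hM, modular_coeffZ_coeffZ h hM,
    modular_coeffZ h hM, hM, deformedEisenstein_one_modular hz, deformedEisenstein_two_modular hz,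
    E2_smul, zpow_add₀ hj, show denom γ τ ^ (2 : ℤ) = denom γ τ ^ 2 from zpow_ofNat _ 2]
  have hK := one_div_mul_cancel hm
  clear hM hj
  generalize denom γ τ ^ w = P
  generalize modFactor m (γ 1 0) (denom γ τ) z = M
  generalize denom γ τ = j
  generalize 1 / (1 - 4 * (m : ℂ)) = K at *
  linear_combination -P * M * (γ 1 0 * z * j * laurentSum (coeffZ c) z τ +
    m * γ 1 0 ^ 2 * z ^ 2 * laurentSum c z τ) * hK

/-! ### Laurent expansion of `∂^J F` near the real axis -/

/-- The points with `0 < |Im z| < Im τ`. -/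
def strip : Set (ℂ × ℍ) := {x | x.1.im ≠ 0 ∧ |x.1.im| < x.2.im}

lemma mem_offLattice_of_strip {z : ℂ} {τ : ℍ} (h : (z, τ) ∈ strip) : z ∈ offLattice τ := by
  rintro l u rfl
  obtain ⟨h1, h2⟩ := h
  simp only [add_im, mul_im, intCast_re, intCast_im, zero_mul, add_zero, coe_im] at h1 h2
  rw [abs_mul, abs_of_pos τ.im_pos] at h2
  have h3 : |(l : ℝ)| < 1 := by
    by_contra h
    have := mul_le_mul_of_nonneg_right (not_lt.mp h) τ.im_pos.le
    linarith
  have h4 : |l| < 1 := by exact_mod_cast h3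
  rw [Int.abs_lt_one_iff] at h4
  simp [h4] at h1

lemma norm_ellNome_mul_nome_lt {z : ℂ} {τ : ℍ} (h : |z.im| < τ.im) :
    ‖ellNome z‖ * ‖nome τ‖ < 1 := by
  rw [norm_nome, norm_ellNome, ← Real.exp_add, Real.exp_lt_one_iff]
  nlinarith [Real.pi_pos, (abs_lt.mp h).1]

/-- Exponents `(n, r)` with `n + r s + m s² ≥ 0` for `0 ≤ s ≤ 1`. -/
def halfCone (m : ℕ) : Set (ℤ × ℤ) :=
  {x | ∀ s : ℝ, 0 ≤ s → s ≤ 1 → 0 ≤ x.1 + x.2 * s + m * s ^ 2}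

lemma jacobiCone_subset_halfCone : jacobiCone m ⊆ halfCone m := fun _ hx s _ _ => hx s

/-- The index is carried by the form alone, so multiplication by `J₁`, `J₂` or `E₂`, of index `0`,
does not change `m`. -/
lemma halfCone_add {x y : ℤ × ℤ} (hx : x ∈ halfCone 0) (hy : y ∈ jacobiCone m) :
    x + y ∈ halfCone m := by
  intro s h0 h1
  have hx' := hx s h0 h1
  have hy' := hy s
  simp only [Nat.cast_zero, zero_mul, add_zero, Prod.fst_add, Prod.snd_add] at hx' ⊢
  push_cast
  linarith

lemma zero_mem_halfCone : (0 : ℤ × ℤ) ∈ halfCone 0 := by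
  intro s _ _
  simp

lemma lambertSum_hasSum (N : ℕ) {x : ℂ} {τ : ℍ} (hx : ‖x‖ * ‖nome τ‖ < 1) :
    HasSum (fun y : ℕ+ × ℕ+ => ((y.2 : ℕ) : ℂ) ^ N * (x ^ (y.1 : ℕ) *
      nome τ ^ ((y.1 : ℕ) * (y.2 : ℕ)))) (lambertSum N τ x) := by
  rw [lambertSum_eq_double N τ hx]
  exact (summable_double N τ hx).hasSum.congr_fun fun y => by ring

lemma hasExpansion_lambertSum (N : ℕ) :
    HasExpansion strip (halfCone 0) fun z τ => lambertSum N τ (ellNome z) := by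
  refine HasExpansion.of_family (ι := ℕ+ × ℕ+)
    (fun y => ((((y.1 : ℕ) * (y.2 : ℕ) : ℕ) : ℤ), ((y.1 : ℕ) : ℤ)))
    (fun y => ((y.2 : ℕ) : ℂ) ^ N) (fun y _ s h0 _ => by positivity) fun z τ hz => ?_
  refine (lambertSum_hasSum N (norm_ellNome_mul_nome_lt hz.2)).congr_fun fun y => ?_
  rw [mono_eq_zpow, zpow_natCast, zpow_natCast]

/-- The exponents `(kr, -k)` give `k(r - s) ≥ 0` only for `s ≤ 1`, because of `r = 1`. This is what
forces the bounded range of `s` in `halfCone`. -/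
lemma hasExpansion_lambertSum_inv (N : ℕ) :
    HasExpansion strip (halfCone 0) fun z τ => lambertSum N τ (ellNome z)⁻¹ := by
  refine HasExpansion.of_family (ι := ℕ+ × ℕ+)
    (fun y => ((((y.1 : ℕ) * (y.2 : ℕ) : ℕ) : ℤ), -((y.1 : ℕ) : ℤ)))
    (fun y => ((y.2 : ℕ) : ℂ) ^ N) (fun y _ s h0 h1 => ?_) fun z τ hz => ?_
  · have h2 : (1 : ℝ) ≤ ((y.2 : ℕ) : ℝ) := by exact_mod_cast y.2.pos
    have h3 : (0 : ℝ) ≤ ((y.1 : ℕ) : ℝ) := by positivity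
    push_cast
    nlinarith [mul_nonneg h3 (sub_nonneg.mpr (h1.trans h2))]
  · have hp : ‖(ellNome z)⁻¹‖ * ‖nome τ‖ < 1 := by
      rw [← ellNome_neg]
      exact norm_ellNome_mul_nome_lt (by simpa using hz.2)
    refine (lambertSum_hasSum N hp).congr_fun fun y => ?_
    rw [mono_eq_zpow, zpow_natCast, zpow_neg, zpow_natCast, inv_pow]

lemma hasExpansion_lambertSum_one (N : ℕ) :
    HasExpansion strip (halfCone 0) fun _ τ => lambertSum N τ 1 := by
  refine HasExpansion.of_family (ι := ℕ+ × ℕ+)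
    (fun y => ((((y.1 : ℕ) * (y.2 : ℕ) : ℕ) : ℤ), 0))
    (fun y => ((y.2 : ℕ) : ℂ) ^ N) (fun y _ s h0 _ => by positivity) fun z τ hz => ?_
  have hp : ‖(1 : ℂ)‖ * ‖nome τ‖ < 1 := by simpa using norm_nome_lt_one τ
  refine (lambertSum_hasSum N hp).congr_fun fun y => ?_
  rw [mono_eq_zpow, zpow_natCast, zpow_zero, one_pow]

lemma hasExpansion_E2 : HasExpansion strip (halfCone 0) fun _ τ => EisensteinSeries.E2 τ := by
  refine ((HasExpansion.const 1 zero_mem_halfCone).add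
    ((hasExpansion_lambertSum_one 1).const_mul (-24))).congr fun z τ _ => ?_
  rw [E2_eq_lambertSum]
  ring

lemma hasExpansion_deformedEisenstein_two :
    HasExpansion strip (halfCone 0) fun z τ => deformedEisenstein 2 z τ := by
  refine ((HasExpansion.const (1 / 6) zero_mem_halfCone).add
    (((hasExpansion_lambertSum 1).add (hasExpansion_lambertSum_inv 1)).const_mul (-2))).congr
    fun z τ hz => ?_
  rw [deformedEisenstein_two (mem_offLattice_of_strip hz)]
  ring

lemma hasExpansion_deformedEisenstein_one_sub :
    HasExpansion strip (halfCone 0) fun z τ =>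
      deformedEisenstein 1 z τ - ellNome z / (ellNome z - 1) := by
  refine ((HasExpansion.const (-(1 / 2)) zero_mem_halfCone).add
    (((hasExpansion_lambertSum 0).const_mul (-1)).add (hasExpansion_lambertSum_inv 0))).congr
    fun z τ hz => ?_
  rw [deformedEisenstein_one (mem_offLattice_of_strip hz)]
  ring

lemma IsConeSeries.hasExpansion (h : IsConeSeries m c) (R : Set (ℂ × ℍ)) :
    HasExpansion R (jacobiCone m) fun z τ => laurentSum c z τ :=
  ⟨c, h.supp, fun z τ _ => h.hasSum z τ⟩

lemma HasExpansion.mul_cone {G : ℂ → ℍ → ℂ} (hG : HasExpansion strip (halfCone 0) G)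
    (h : IsConeSeries m c) :
    HasExpansion strip (halfCone m) fun z τ => G z τ * laurentSum c z τ :=
  hG.mul (h.hasExpansion strip) fun _ hx _ hy => halfCone_add hx hy

/-- The rows of a cone series are summable. -/
lemma IsConeSeries.summable_row (h : IsConeSeries m c) (n : ℤ) :
    Summable fun s : ℤ => c (n, s) := by
  have h1 := (h.summable 0 I (by simp)).prod_factor n
  simp only [mono, mul_zero, add_zero] at h1
  exact (summable_mul_right_iff (Complex.exp_ne_zero _)).mp h1

/-- The shear `((n, s), j) ↦ ((n, s + a j + b), j)`. -/
def shear (a b : ℤ) : (ℤ × ℤ) × ℕ ≃ (ℤ × ℤ) × ℕ where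
  toFun x := ((x.1.1, x.1.2 + (a * x.2 + b)), x.2)
  invFun x := ((x.1.1, x.1.2 - (a * x.2 + b)), x.2)
  left_inv x := by simp
  right_inv x := by simp

/-- Division of a cone series with vanishing row sums by `1 - p⁻¹`. -/
lemma hasExpansion_div (h : IsConeSeries m c) (h0 : ∀ n : ℤ, ∑' s : ℤ, c (n, s) = 0) :
    HasExpansion strip (jacobiCone m) fun z τ =>
      ellNome z / (ellNome z - 1) * laurentSum c z τ := by
  have hup : ∀ n r : ℤ, Summable fun j : ℕ => c (n, r + (1 * (j : ℤ) + 0)) := by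
    intro n r
    refine (h.summable_row n).comp_injective (i := fun j : ℕ => r + (1 * (j : ℤ) + 0)) ?_
    intro a b hab
    simpa using hab
  have hdown : ∀ n r : ℤ, Summable fun j : ℕ => c (n, r + ((-1) * (j : ℤ) + (-1))) := by
    intro n r
    refine (h.summable_row n).comp_injective (i := fun j : ℕ => r + ((-1) * (j : ℤ) + (-1))) ?_
    intro a b hab
    simpa using hab
  -- These are the coefficients obtained from `∑ p⁻ʲ`, valid for `|p| > 1`. Vanishing row sums make
  -- them equal to the coefficients obtained from `-∑ pʲ⁺¹`, valid for `|p| < 1`.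
  set e : ℤ × ℤ → ℂ := fun x => ∑' j : ℕ, c (x.1, x.2 + (1 * (j : ℤ) + 0)) with he
  have hneg : ∀ n r : ℤ, ∑' j : ℕ, c (n, r + ((-1) * (j : ℤ) + (-1))) = -e (n, r) := by
    intro n r
    have h1 : HasSum (fun s : ℤ => c (n, r + s)) 0 := by
      rw [← h0 n]
      exact (Equiv.addLeft r).hasSum_iff.mpr (h.summable_row n).hasSum
    have h2 := HasSum.of_nat_of_neg_add_one (f := fun s : ℤ => c (n, r + s))
      ((hup n r).hasSum.congr_fun fun j => by simp)
      ((hdown n r).hasSum.congr_fun fun j => by congr 2; ring)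
    have h3 := h2.unique h1
    rw [add_comm] at h3
    exact eq_neg_of_add_eq_zero_left h3
  refine ⟨e, ?_, ?_⟩
  · rintro ⟨n, r⟩ hx
    -- By the two formulas for `e`, the row has a nonzero coefficient at or above `r` and one below
    -- `r`. As `n + rs + ms²` is affine in `r`, the exponent `(n, r)` between them lies in the cone.
    obtain ⟨j, hj⟩ : ∃ j : ℕ, c (n, r + (1 * (j : ℤ) + 0)) ≠ 0 := by
      by_contra! hall
      exact hx (by simp only [he, hall, tsum_zero])
    obtain ⟨i, hi⟩ : ∃ i : ℕ, c (n, r + ((-1) * (i : ℤ) + (-1))) ≠ 0 := by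
      by_contra! hall
      refine hx ?_
      have := hneg n r
      simp only [hall, tsum_zero] at this
      exact (neg_eq_zero.mp this.symm)
    intro s
    have h1 := h.supp _ hj s
    have h2 := h.supp _ hi s
    push_cast at h1 h2 ⊢
    rcases le_total 0 s with hs | hs
    · nlinarith [mul_nonneg (Nat.cast_nonneg (α := ℝ) i) hs]
    · nlinarith [mul_nonneg (Nat.cast_nonneg (α := ℝ) j) (neg_nonneg.mpr hs)]
  · intro z τ hz
    have hp0 := ellNome_ne_zero z
    have hp1 : ellNome z - 1 ≠ 0 :=
      sub_ne_zero.mpr (ellNome_ne_one (mem_offLattice_of_strip hz))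
    have hF := h.hasSum z τ
    rcases lt_or_gt_of_ne hz.1 with him | him
    · have hlt : ‖(ellNome z)⁻¹‖ < 1 := by
        rw [norm_inv, norm_ellNome, ← Real.exp_neg, Real.exp_lt_one_iff]
        nlinarith [Real.pi_pos]
      have hg := hasSum_geometric_of_norm_lt_one hlt
      have h12 := summable_mul_of_summable_norm (f := fun x => c x * mono x z τ)
        (g := fun j : ℕ => (ellNome z)⁻¹ ^ j) hF.summable.norm hg.summable.norm
      -- After the shear, the first index of the product series is the total exponent, so summing
      -- over `j` yields its coefficient.
      have h1 := ((shear 1 0).hasSum_iff.mpr (hF.mul hg h12))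
      have h2 := h1.prod_fiberwise (g := fun x => e x * mono x z τ) fun x => by
        refine ((hup x.1 x.2).hasSum.mul_right (mono x z τ)).congr_fun fun j => ?_
        simp only [Function.comp, shear, Equiv.coe_fn_mk]
        rw [mul_assoc, mono_eq_zpow, mono_eq_zpow, zpow_add₀ hp0, add_zero, one_mul, zpow_natCast,
          inv_pow]
        field_simp
      convert! h2 using 1
      have h5 : 1 - (ellNome z)⁻¹ = (ellNome z - 1) / ellNome z := by field_simp
      rw [h5, inv_div, mul_comm]
    · have hlt : ‖ellNome z‖ < 1 := by
        rw [norm_ellNome, Real.exp_lt_one_iff]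
        nlinarith [Real.pi_pos]
      have hg := (hasSum_geometric_of_norm_lt_one hlt).mul_left (-ellNome z)
      have h12 := summable_mul_of_summable_norm (f := fun x => c x * mono x z τ)
        (g := fun j : ℕ => -ellNome z * ellNome z ^ j) hF.summable.norm hg.summable.norm
      have h1 := ((shear (-1) (-1)).hasSum_iff.mpr (hF.mul hg h12))
      have h2 := h1.prod_fiberwise (g := fun x => e x * mono x z τ) fun x => by
        have h3 := ((hdown x.1 x.2).hasSum.mul_right (mono x z τ)).neg
        rw [hneg, neg_mul, neg_neg] at h3
        refine h3.congr_fun fun j => ?_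
        simp only [Function.comp, shear, Equiv.coe_fn_mk]
        rw [mul_assoc, mono_eq_zpow, mono_eq_zpow, zpow_add₀ hp0, neg_one_mul, ← neg_add, zpow_neg,
          zpow_add₀ hp0, zpow_natCast, zpow_one]
        field_simp
      convert! h2 using 1
      have h5 : 1 - ellNome z = -(ellNome z - 1) := by ring
      rw [h5, inv_neg, neg_mul_neg, mul_comm, ← div_eq_mul_inv]

/-- The Laurent expansion of `∂^J F` on the strip. -/
lemma hasExpansion_serreSeries (w : ℂ) (h : IsConeSeries m c)
    (h0 : ∀ n : ℤ, ∑' s : ℤ, coeffZ c (n, s) = 0) :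
    HasExpansion strip (halfCone m) (serreSeries w m c) := by
  have hsub := jacobiCone_subset_halfCone (m := m)
  have t1 := (h.coeffTau.hasExpansion strip).mono_set subset_rfl hsub
  have t2 := (hasExpansion_E2.mul_cone h).const_mul (-w / 12 - 1 / (1 - 4 * (m : ℂ)) * (m / 6))
  have t3 := (h.coeffZ.coeffZ.hasExpansion strip).mono_set subset_rfl hsub
  have t4 := (hasExpansion_div h.coeffZ h0).mono_set subset_rfl hsub
  have t5 := hasExpansion_deformedEisenstein_one_sub.mul_cone h.coeffZ
  have t6 := (hasExpansion_deformedEisenstein_two.mul_cone h).const_mul (m : ℂ)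
  refine ((t1.add t2).add ((t3.add (((t4.add t5).const_mul (-1)).add t6)).const_mul
    (1 / (1 - 4 * (m : ℂ))))).congr fun z τ _ => ?_
  rw [serreSeries]
  ring

/-! ### From the strip to the whole plane -/

/-- Invariance moves `(n, r)` to `(n + rl + ml², r + 2ml)`, which replaces `s` by `s + l` in `n + rs
+ ms²`. With `l = ⌊s⌋` any `s` reduces to its fractional part. -/
lemma mem_jacobiCone_of_invariant {d : ℤ × ℤ → ℂ} (hd : ∀ x, d x ≠ 0 → x ∈ halfCone m)
    (hinv : ∀ n r : ℤ, d (n - r, r) = d (n + m, r + 2 * m)) (x : ℤ × ℤ) (hx : d x ≠ 0) :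
    x ∈ jacobiCone m := by
  obtain ⟨n, r⟩ := x
  have hshift : ∀ l : ℤ, d (n + r * l + m * l ^ 2, r + 2 * m * l) ≠ 0 := by
    intro l
    induction l using Int.induction_on with
    | zero => simpa using hx
    | succ l ih =>
      have h1 := hinv (n + r * l + m * l ^ 2 + (r + 2 * m * l)) (r + 2 * m * l)
      rw [add_sub_cancel_right] at h1
      rw [h1] at ih
      convert ih using 3 <;> ring
    | pred l ih =>
      have h1 := hinv (n + r * (-l) + m * (-l) ^ 2 - m) (r + 2 * m * (-l) - 2 * m)
      rw [sub_add_cancel, sub_add_cancel] at h1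
      rw [← h1] at ih
      convert ih using 3 <;> ring
  intro s
  have h1 := hd _ (hshift ⌊s⌋) (Int.fract s) (Int.fract_nonneg s) (Int.fract_lt_one s).le
  have h2 := Int.floor_add_fract s
  push_cast at h1
  have h3 : (n : ℝ) + r * s + m * s ^ 2 = n + r * ⌊s⌋ + m * ⌊s⌋ ^ 2 +
      (r + 2 * m * ⌊s⌋) * Int.fract s + m * Int.fract s ^ 2 := by
    conv_lhs => rw [← h2]
    ring
  simp only
  rw [h3]
  exact h1

/-- A function on the strip with the elliptic transformation law has Laurent coefficients
invariant under the corresponding shift. -/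
lemma coeff_shift_invariant {d : ℤ × ℤ → ℂ} {G : ℂ → ℍ → ℂ}
    (hs : ∀ z τ, (z, τ) ∈ strip → HasSum (fun x => d x * mono x z (τ : ℍ)) (G z τ))
    (hG : ∀ z τ, (z, τ) ∈ strip → G (z + τ) τ = ellFactor m 1 z τ * G z τ) (n r : ℤ) :
    d (n - r, r) = d (n + m, r + 2 * m) := by
  let e₁ : ℤ × ℤ ≃ ℤ × ℤ :=
    { toFun := fun x => (x.1 - x.2, x.2), invFun := fun x => (x.1 + x.2, x.2)
      left_inv := fun x => by simp, right_inv := fun x => by simp }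
  let e₂ : ℤ × ℤ ≃ ℤ × ℤ :=
    { toFun := fun x => (x.1 + m, x.2 + 2 * m), invFun := fun x => (x.1 - m, x.2 - 2 * m)
      left_inv := fun x => by simp, right_inv := fun x => by simp }
  have key : (fun x => d (e₁ x)) = fun x => d (e₂ x) := by
    -- With `Im z = -1/2` and `Im τ = 1`, both `z` and `z + τ` lie in the strip, on opposite sides
    -- of the real axis; this is why one expansion valid on both sides is needed.
    have hz : ∀ s u : ℝ, (((-1 / 2 : ℝ) : ℂ) * I + s).im = -1 / 2 := by intro s u; simp
    have ht : ∀ u : ℝ, (I + (u : ℂ)).im = 1 := by intro u; simp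
    have htpos : ∀ u : ℝ, 0 < (I + (u : ℂ)).im := by intro u; rw [ht]; exact one_pos
    refine coeff_unique (z := ((-1 / 2 : ℝ) : ℂ) * I) (t := I)
      (fun s u => G (((-1 / 2 : ℝ) : ℂ) * I + s + (I + u)) ⟨I + u, htpos u⟩) ?_ ?_
    · intro s u
      have hmem : ((((-1 / 2 : ℝ) : ℂ) * I + s + (I + u)), (⟨I + u, htpos u⟩ : ℍ)) ∈ strip := by
        constructor
        · simp only [add_im, hz s u, ht]
          norm_num
        · change |(((-1 / 2 : ℝ) : ℂ) * I + s + (I + u)).im| < (I + (u : ℂ)).im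
          rw [add_im, hz s u, ht]
          norm_num [abs_lt]
      refine (e₁.hasSum_iff.mpr (hs _ _ hmem)).congr_fun fun x => ?_
      simp only [Function.comp, mono, e₁, Equiv.coe_fn_mk]
      congr 2
      push_cast
      ring
    · intro s u
      have hmem : ((((-1 / 2 : ℝ) : ℂ) * I + s), (⟨I + u, htpos u⟩ : ℍ)) ∈ strip := by
        constructor
        · simp only [hz s u]
          norm_num
        · change |(((-1 / 2 : ℝ) : ℂ) * I + s).im| < (I + (u : ℂ)).im
          rw [hz s u, ht]
          norm_num [abs_lt]
      have h1 := hG _ _ hmem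
      rw [UpperHalfPlane.coe_mk] at h1
      rw [h1]
      refine ((e₂.hasSum_iff.mpr (hs _ _ hmem)).mul_left _).congr_fun fun x => ?_
      simp only [Function.comp, mono, e₂, Equiv.coe_fn_mk, ellFactor]
      rw [mul_left_comm, ← Complex.exp_add]
      congr 2
      push_cast
      ring
  exact congrFun key (n, r)

/-- The row sums are the `q`-coefficients of `F^•(0, τ)`. Evenness gives `c(n, -s) = c(n, s)`, so `s
c(n, s)` is odd in `s`. -/
lemma row_sum_coeffZ_eq_zero (h : IsConeSeries m c)
    (heven : ∀ (z : ℂ) (τ : ℍ), laurentSum c (-z) τ = laurentSum c z τ) (n : ℤ) :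
    ∑' s : ℤ, coeffZ c (n, s) = 0 := by
  let e : ℤ × ℤ ≃ ℤ × ℤ :=
    { toFun := fun x => (x.1, -x.2), invFun := fun x => (x.1, -x.2)
      left_inv := fun x => by simp, right_inv := fun x => by simp }
  have htpos : ∀ u : ℝ, 0 < (I + (u : ℂ)).im := by intro u; simp
  have key : (fun x => c (e x)) = c := by
    refine coeff_unique (z := 0) (t := I) (fun s u => laurentSum c (0 + s) (I + u)) ?_ ?_
    · intro s u
      have h1 := h.hasSum (-(0 + s)) ⟨I + u, htpos u⟩
      rw [heven] at h1
      refine (e.hasSum_iff.mpr h1).congr_fun fun x => ?_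
      simp only [Function.comp, mono, e, Equiv.coe_fn_mk]
      congr 2
      push_cast
      ring
    · intro s u
      exact h.hasSum (0 + s) ⟨I + u, htpos u⟩
  have h1 : ∀ s : ℤ, coeffZ c (n, -s) = -coeffZ c (n, s) := by
    intro s
    have := congrFun key (n, s)
    simp only [e, Equiv.coe_fn_mk] at this
    simp only [coeffZ, this]
    push_cast
    ring
  have h2 := (Equiv.neg ℤ).tsum_eq fun s : ℤ => coeffZ c (n, s)
  simp only [Equiv.neg_apply, h1, tsum_neg] at h2
  exact self_eq_neg.mp h2.symm

lemma differentiableAt_serreSeries (w : ℂ) (h : IsConeSeries m c) {τ : ℍ} {z : ℂ}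
    (hz : z ∈ offLattice τ) : DifferentiableAt ℂ (fun z => serreSeries w m c z τ) z := by
  have d0 := h.differentiable_fst τ z
  have d1 := h.coeffTau.differentiable_fst τ z
  have d2 := h.coeffZ.differentiable_fst τ z
  have d3 := h.coeffZ.coeffZ.differentiable_fst τ z
  have j1 := differentiableAt_deformedEisenstein 1 τ hz
  have j2 := differentiableAt_deformedEisenstein 2 τ hz
  exact (d1.sub (d0.const_mul _)).add
    (((((d3.sub (j1.mul d2)).add ((j2.const_mul _).mul d0)).sub (d0.const_mul _))).const_mul _)

/-- `∂^J F` extends to a Laurent series with exponents in the Jacobi cone. -/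
theorem exists_coneSeries_eq_serreSeries (w : ℂ) (h : IsConeSeries m c)
    (hE : ∀ (l u : ℤ) (z : ℂ) (τ : ℍ),
      laurentSum c (z + l * τ + u) τ = ellFactor m l z τ * laurentSum c z τ)
    (heven : ∀ (z : ℂ) (τ : ℍ), laurentSum c (-z) τ = laurentSum c z τ) :
    ∃ d, IsConeSeries m d ∧
      ∀ (τ : ℍ), ∀ z ∈ offLattice τ, laurentSum d z τ = serreSeries w m c z τ := by
  obtain ⟨d, hd, hs⟩ := hasExpansion_serreSeries w h (row_sum_coeffZ_eq_zero h heven)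
  have hinv := coeff_shift_invariant (m := m) hs fun z τ hz => by
    simpa using serreSeries_elliptic w h hE 1 0 (mem_offLattice_of_strip hz)
  have hmem : ∀ τ : ℍ, (((τ.im / 2 : ℝ) : ℂ) * I, τ) ∈ strip := by
    intro τ
    have := τ.im_pos
    constructor
    · simp [this.ne']
    · simp only [mul_im, ofReal_re, Complex.I_im, mul_one, ofReal_im, Complex.I_re, mul_zero, add_zero]
      rw [abs_of_pos (by linarith)]
      linarith
  have hcone : IsConeSeries m d := .of_exists (mem_jacobiCone_of_invariant hd hinv)
    fun t ht => ⟨_, (hs _ _ (hmem ⟨t, ht⟩)).summable⟩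
  refine ⟨d, hcone, fun τ z hz => ?_⟩
  have ho := isOpen_offLattice τ
  have ha : AnalyticOnNhd ℂ (fun z => laurentSum d z τ) (offLattice τ) :=
    (hcone.differentiable_fst τ).differentiableOn.analyticOnNhd ho
  have hb : AnalyticOnNhd ℂ (fun z => serreSeries w m c z τ) (offLattice τ) :=
    DifferentiableOn.analyticOnNhd
      (fun z hz => (differentiableAt_serreSeries w h hz).differentiableWithinAt) ho
  -- Identity theorem: the lattice is countable, so its complement is connected, and the two
  -- functions agree near a point of the strip.
  refine ha.eqOn_of_preconnected_of_eventuallyEq hb (isPreconnected_offLattice τ)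
    (mem_offLattice_of_strip (hmem τ)) ?_ hz
  have hopen : IsOpen {z : ℂ | z.im ≠ 0 ∧ |z.im| < τ.im} :=
    (isOpen_ne_fun Complex.continuous_im continuous_const).inter
      (isOpen_lt Complex.continuous_im.abs continuous_const)
  filter_upwards [hopen.mem_nhds (hmem τ)] with y hy
  exact (hs y τ hy).tsum_eq

/-! ### The operator `∂^J` -/

/-- The right-hand side of the formula defining `∂^J F`, where `w` is the weight of `F`. -/
def serreFormula (w : ℂ) (m : ℕ) (F : ℂ → ℍ → ℂ) (z : ℂ) (τ : ℍ) : ℂ :=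
  tauDeriv F z τ - w / 12 * EisensteinSeries.E2 τ * F z τ + 1 / (1 - 4 * (m : ℂ)) *
    (zDeriv (zDeriv F) z τ - deformedEisenstein 1 z τ * zDeriv F z τ +
      m * deformedEisenstein 2 z τ * F z τ - (m : ℂ) / 6 * EisensteinSeries.E2 τ * F z τ)

lemma serreFormula_eq (w : ℂ) (h : IsConeSeries m c) :
    serreFormula w m (fun z (τ : ℍ) => laurentSum c z τ) = serreSeries w m c := by
  have h1 := h.zDeriv
  have h2 := h.coeffZ.zDeriv
  have h3 := h.tauDeriv
  unfold coeffZ at h2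
  funext z τ
  rw [serreFormula, h1, h2, h3]
  rfl

lemma laurentSum_add_smul {d : ℤ × ℤ → ℂ} (hc : IsConeSeries m c) (hd : IsConeSeries m d) (a : ℂ)
    (z : ℂ) (τ : ℍ) :
    laurentSum (c + a • d) z τ = laurentSum c z τ + a * laurentSum d z τ := by
  refine (((hc.hasSum z τ).add ((hd.hasSum z τ).mul_left a)).congr_fun fun x => ?_).tsum_eq
  simp only [Pi.add_apply, Pi.smul_apply, smul_eq_mul]
  ring

lemma IsConeSeries.add_smul {d : ℤ × ℤ → ℂ} (hc : IsConeSeries m c) (hd : IsConeSeries m d)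
    (a : ℂ) : IsConeSeries m (c + a • d) := by
  refine ⟨fun x hx => ?_, fun z t ht => ?_⟩
  · by_contra hK
    refine hx ?_
    simp [of_not_not fun h0 => hK (hc.supp x h0), of_not_not fun h0 => hK (hd.supp x h0)]
  · refine ((hc.summable z t ht).add ((hd.summable z t ht).mul_left a)).congr fun x => ?_
    simp only [Pi.add_apply, Pi.smul_apply, smul_eq_mul]
    ring

lemma coeffZ_add_smul (c d : ℤ × ℤ → ℂ) (a : ℂ) :
    coeffZ (c + a • d) = coeffZ c + a • coeffZ d := by
  funext x
  simp only [coeffZ, Pi.add_apply, Pi.smul_apply, smul_eq_mul]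
  ring

lemma coeffTau_add_smul (c d : ℤ × ℤ → ℂ) (a : ℂ) :
    coeffTau (c + a • d) = coeffTau c + a • coeffTau d := by
  funext x
  simp only [coeffTau, Pi.add_apply, Pi.smul_apply, smul_eq_mul]
  ring

lemma serreFormula_add_smul (w : ℂ) {k : ℤ} (F G : jacobiForms k m) (a : ℂ) (z : ℂ) (τ : ℍ) :
    serreFormula w m (F + a • G : jacobiForms k m) z τ =
      serreFormula w m F z τ + a * serreFormula w m G z τ := by
  obtain ⟨F, hF⟩ := F
  obtain ⟨G, hG⟩ := G
  obtain ⟨c, hc, rfl⟩ := IsJacobiForm.exists_coneSeries hF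
  obtain ⟨d, hd, rfl⟩ := IsJacobiForm.exists_coneSeries hG
  have e : (((⟨_, hF⟩ : jacobiForms k m) + a • (⟨_, hG⟩ : jacobiForms k m) : jacobiForms k m) :
      ℂ → ℍ → ℂ) = fun z (τ : ℍ) => laurentSum (c + a • d) z τ := by
    funext z τ
    exact (laurentSum_add_smul hc hd a z τ).symm
  rw [e, serreFormula_eq w (hc.add_smul hd a), serreFormula_eq w hc, serreFormula_eq w hd]
  simp only [serreSeries, coeffZ_add_smul, coeffTau_add_smul, laurentSum_add_smul hc hd,
    laurentSum_add_smul hc.coeffZ hd.coeffZ, laurentSum_add_smul hc.coeffTau hd.coeffTau,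
    laurentSum_add_smul hc.coeffZ.coeffZ hd.coeffZ.coeffZ]
  ring

/-- The matrix `-1` fixes `τ`, sends `z` to `-z` and has factor `(-1)^(2k) = 1`. -/
lemma even_of_modular {k : ℤ}
    (hM : ∀ (γ : SL(2, ℤ)) (z : ℂ) (τ : ℍ), laurentSum c (z / denom γ τ) (γ • τ : ℍ) =
      denom γ τ ^ (2 * k) * modFactor m (γ 1 0) (denom γ τ) z * laurentSum c z τ)
    (z : ℂ) (τ : ℍ) : laurentSum c (-z) τ = laurentSum c z τ := by
  have h := hM (-1) z τ
  have hj : denom (-1 : SL(2, ℤ)) τ = -1 := by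
    rw [denom_SL]
    simp
  have h10 : (-1 : SL(2, ℤ)) 1 0 = 0 := by simp
  rw [hj, h10, ModularGroup.SL_neg_smul, one_smul] at h
  rw [zpow_mul, div_neg, div_one] at h
  simpa [modFactor] using h

/-- The value of `∂^J F` on the zero section. -/
lemma tendsto_serreSeries (w : ℂ) (h : IsConeSeries m c)
    (heven : ∀ (z : ℂ) (τ : ℍ), laurentSum c (-z) τ = laurentSum c z τ) (τ : ℍ) :
    Filter.Tendsto (fun z => serreSeries w m c z τ) (nhdsWithin 0 {0}ᶜ)
      (nhds (laurentSum (coeffTau c) 0 τ -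
        w / 12 * EisensteinSeries.E2 τ * laurentSum c 0 τ)) := by
  have hcont : ∀ {d : ℤ × ℤ → ℂ}, IsConeSeries m d →
      Filter.Tendsto (fun z => laurentSum d z τ) (nhdsWithin 0 {0}ᶜ)
        (nhds (laurentSum d 0 τ)) := fun hd =>
    ((hd.differentiable_fst τ).continuous.tendsto 0).mono_left nhdsWithin_le_nhds
  have hz0 : laurentSum (coeffZ c) 0 τ = 0 := by
    have h1 := h.hasDerivAt_z (hasDerivAt_id (0 : ℂ)) τ
    have h2 := h.hasDerivAt_z (hasDerivAt_neg (0 : ℂ)) τ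
    simp only [heven, neg_zero, id] at h1 h2
    have h3 := mul_left_cancel₀ Complex.two_pi_I_ne_zero (h1.unique h2)
    linear_combination h3 / 2
  have hslope := hasDerivAt_iff_tendsto_slope.mp (h.coeffZ.hasDerivAt_z (hasDerivAt_id (0 : ℂ)) τ)
  simp only [id, mul_one] at hslope
  -- `J₁F^• = (zJ₁)(F^•/z)` tends to `(2πi)⁻¹ · 2πi F^••(0, τ)`, since the odd function `F^•`
  -- vanishes at `0`.
  have hJ := (tendsto_mul_deformedEisenstein_one τ).mul hslope
  rw [inv_mul_cancel_left₀ Complex.two_pi_I_ne_zero] at hJ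
  have hJ' : Filter.Tendsto (fun z => deformedEisenstein 1 z τ * laurentSum (coeffZ c) z τ)
      (nhdsWithin 0 {0}ᶜ) (nhds (laurentSum (coeffZ (coeffZ c)) 0 τ)) := by
    refine hJ.congr' ?_
    filter_upwards [self_mem_nhdsWithin] with z hz
    have hz' : z ≠ 0 := hz
    rw [slope_def_field, hz0, sub_zero, sub_zero]
    field_simp
  have key := ((hcont h.coeffTau).sub ((hcont h).const_mul (w / 12 * EisensteinSeries.E2 τ))).add
    (((((hcont h.coeffZ.coeffZ).sub hJ').add
      (((tendsto_deformedEisenstein_two τ).const_mul (m : ℂ)).mul (hcont h))).sub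
        ((hcont h).const_mul ((m : ℂ) / 6 * EisensteinSeries.E2 τ))).const_mul
          (1 / (1 - 4 * (m : ℂ))))
  convert! key using 2
  ring

/-- The image of a Jacobi form of weight `2k` under `∂^J`. -/
theorem exists_jacobiSerre (k m : ℕ) (F : jacobiForms (2 * k) m) :
    ∃ H : jacobiForms (2 * k + 2) m,
      (∀ (z : ℂ) (τ : ℍ), z ∈ offLattice τ →
        (H : ℂ → ℍ → ℂ) z τ = serreFormula (2 * k : ℂ) m F z τ) ∧
      ∀ τ : ℍ, (H : ℂ → ℍ → ℂ) 0 τ =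
        Derivative.serreDerivative (2 * k : ℂ) (fun t : ℍ => (F : ℂ → ℍ → ℂ) 0 t) τ := by
  obtain ⟨F, hF⟩ := F
  change IsJacobiForm (2 * k) m F at hF
  obtain ⟨c, h, rfl⟩ := hF.exists_coneSeries
  have hM := hF.modular
  have hE := hF.elliptic
  have heven := even_of_modular hM
  obtain ⟨d, hd, hds⟩ := exists_coneSeries_eq_serreSeries (2 * k : ℂ) h hE heven
  have hcast : ((2 * (k : ℤ) : ℤ) : ℂ) = 2 * k := by push_cast; rfl
  have hcont : ∀ τ : ℍ, Continuous fun z => laurentSum d z τ :=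
    fun τ => (hd.differentiable_fst τ).continuous
  have hH : IsJacobiForm (2 * k + 2) m fun z (τ : ℍ) => laurentSum d z τ := by
    -- Both transformation laws are known off the lattice and extend to all `z` by continuity and
    -- density.
    refine ⟨hd.differentiableOn, fun γ z τ => ?_, fun l u z τ => ?_, hd.fourier⟩
    · refine eq_of_eqOn_offLattice (τ := τ)
        (f := fun z => laurentSum d (z / denom γ τ) (γ • τ : ℍ))
        (g := fun z => denom γ τ ^ (2 * (k : ℤ) + 2) *
          cexp (2 * π * I * m * (γ 1 0 : ℂ) * z ^ 2 / denom γ τ) * laurentSum d z τ)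
        ((hcont (γ • τ)).comp (continuous_id.div_const _)) ?_ (fun z hz => ?_) z
      · exact Continuous.mul (by fun_prop) (hcont τ)
      · rw [hds _ _ (div_denom_mem_offLattice hz), hds _ _ hz, ← hcast]
        exact serreSeries_modular h hM γ hz
    · refine eq_of_eqOn_offLattice (τ := τ)
        (f := fun z => laurentSum d (z + l * τ + u) τ)
        (g := fun z => cexp (-(2 * π * I * m * ((l : ℂ) ^ 2 * τ + 2 * l * z))) * laurentSum d z τ)
        ((hcont τ).comp (by fun_prop)) ?_ (fun z hz => ?_) z
      · exact Continuous.mul (by fun_prop) (hcont τ)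
      · rw [hds _ _ (offLattice_add hz l u), hds _ _ hz]
        exact serreSeries_elliptic _ h hE l u hz
  refine ⟨⟨fun z τ => laurentSum d z τ, hH⟩, fun z τ hz => ?_, fun τ => ?_⟩
  · rw [serreFormula_eq _ h]
    exact hds τ z hz
  · have h1 : Filter.Tendsto (fun z => laurentSum d z τ) (nhdsWithin 0 {0}ᶜ)
        (nhds (laurentSum d 0 τ)) := ((hcont τ).tendsto 0).mono_left nhdsWithin_le_nhds
    have h2 := tendsto_serreSeries (2 * k : ℂ) h heven τ
    have h3 := tendsto_nhds_unique h1 (h2.congr' (by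
      filter_upwards [eventually_offLattice τ] with z hz
      exact (hds τ z hz).symm))
    have h4 := congrFun (congrFun h.tauDeriv 0) τ
    rw [tauDeriv] at h4
    rw [Derivative.serreDerivative_apply, h4]
    refine h3.trans ?_
    rw [div_eq_mul_inv]
    rfl

/-- Jacobi forms that agree off the lattice are equal. -/
lemma jacobiForms_ext {k : ℤ} {F G : jacobiForms k m}
    (h : ∀ (z : ℂ) (τ : ℍ), z ∈ offLattice τ →
      (F : ℂ → ℍ → ℂ) z τ = (G : ℂ → ℍ → ℂ) z τ) : F = G := by
  obtain ⟨F, hF⟩ := F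
  obtain ⟨G, hG⟩ := G
  obtain ⟨c, hc, rfl⟩ := IsJacobiForm.exists_coneSeries hF
  obtain ⟨d, hd, rfl⟩ := IsJacobiForm.exists_coneSeries hG
  refine Subtype.ext (funext fun z => funext fun τ => ?_)
  exact eq_of_eqOn_offLattice (hc.differentiable_fst τ).continuous
    (hd.differentiable_fst τ).continuous (fun z hz => h z τ hz) z

end JacobiSerre

end

theorem theorem0p1 (k m : ℕ) :
    ∃ D : JacobiSerre.jacobiForms (2 * k) m →ₗ[ℂ] JacobiSerre.jacobiForms (2 * k + 2) m,
      (∀ (F : JacobiSerre.jacobiForms (2 * k) m) (z : ℂ) (τ : ℍ),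
        (∀ l u : ℤ, z ≠ l * τ + u) →
        (D F : ℂ → ℍ → ℂ) z τ =
          JacobiSerre.tauDeriv F z τ
            - (2 * k : ℂ) / 12 * EisensteinSeries.E2 τ * (F : ℂ → ℍ → ℂ) z τ
            + 1 / (1 - 4 * (m : ℂ)) *
              (JacobiSerre.zDeriv (JacobiSerre.zDeriv F) z τ
                - JacobiSerre.deformedEisenstein 1 z τ * JacobiSerre.zDeriv F z τ
                + m * JacobiSerre.deformedEisenstein 2 z τ * (F : ℂ → ℍ → ℂ) z τ
                - (m : ℂ) / 6 * EisensteinSeries.E2 τ * (F : ℂ → ℍ → ℂ) z τ)) ∧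
      (∀ (F : JacobiSerre.jacobiForms (2 * k) m) (τ : ℍ),
        (D F : ℂ → ℍ → ℂ) 0 τ =
          Derivative.serreDerivative (2 * k : ℂ) (fun t : ℍ => (F : ℂ → ℍ → ℂ) 0 t) τ) := by
  choose Φ hΦ hΦ0 using JacobiSerre.exists_jacobiSerre k m
  -- The chosen image is determined by its values off the lattice, where the formula is linear in
  -- `F`; hence the choice is linear.
  have hlin : ∀ F G (a : ℂ), Φ (F + a • G) = Φ F + a • Φ G := by
    intro F G a
    refine JacobiSerre.jacobiForms_ext fun z τ hz => ?_
    rw [hΦ _ z τ hz, JacobiSerre.serreFormula_add_smul, ← hΦ F z τ hz, ← hΦ G z τ hz]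
    rfl
  have hzero : Φ 0 = 0 := by
    have h := hlin 0 0 1
    rw [one_smul, one_smul, add_zero] at h
    exact left_eq_add.mp h
  exact ⟨{ toFun := Φ
           map_add' := fun F G => by simpa using hlin F G 1
           map_smul' := fun a G => by simpa [hzero] using hlin 0 G a },
    fun F z τ hz => hΦ F z τ hz, hΦ0⟩
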